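/- Let $\lambda\in(0,\infty)$, $D\in(0,\tfrac12]$ and let $\nu$ be a probability measure on $(0,\infty)$. On a probability space let $W=(W_t)_{t\ge0}$ be a standard Brownian motion, let $(\tau_n)_{n\in\mathbb Z}$ be the points of a Poisson point process on $\mathbb R$ with intensity $\lambda$, listed in increasing order and labelled so that $\tau_0<0<\tau_1$, and let $(\sigma_n)_{n\ge0}$ be i.i.d. random variables with law $\nu$; assume that $W$, $(\tau_n)_{n\in\mathbb Z}$ and $(\sigma_n)_{n\ge 0}$ are independent. For $t\ge0$ put $i(t):=\sup\{n\ge0:\tau_n\le t\}$, $$I_t:=\sigma_{i(t)}^2\,(t-\tau_{i(t)})^{2D}+\sum_{k=1}^{i(t)}\sigma_{k-1}^2\,(\tau_k-\tau_{k-1})^{2D}-\sigma_0^2\,(-\tau_0)^{2D},\qquad X_t:=W_{I_t}.$$ Let $\sigma\sim\nu$, $S\sim\mathrm{Exp}(1)$ and $W_1\sim\mathcal N(0,1)$ be independent, and for $x\ge 0$ let $$\phi(x):=\mathrm{Cov}\big(\sigma S^{D-1/2},\ \sigma (S+x)^{D-1/2}\big).$$ Denote by $\rho(Y,Z):=\mathrm{Cov}(Y,Z)/\sqrt{\mathrm{Var}(Y)\,\mathrm{Var}(Z)}$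 the correlation coefficient of two random variables. Assume that $E(\sigma^2)<\infty$. Then all random variables whose variances and covariances appear here are square integrable, the variances in the denominators are strictly positive, and for all $s,t>0$ with $s\neq t$ $$\lim_{h\downarrow0}\rho\big(|X_{s+h}-X_s|,\,|X_{t+h}-X_t|\big)=\frac{2}{\pi\,\mathrm{Var}\big(\sigma\,|W_1|\,S^{D-1/2}\big)}\;e^{-\lambda|t-s|}\,\phi(\lambda|t-s|).$$ -/

import Mathlib

open MeasureTheory ProbabilityTheory Set Filter Topology
open scoped NNReal ENNReal

noncomputable section

namespace TimeChange

variable {Ω : Type*} [MeasurableSpace Ω]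

/-- A random set `T` of points of the line is a (homogeneous) Poisson point process on `ℝ` with
intensity `lam`: the number of points in a Borel set `B` of finite length has the Poisson law with
mean `lam * length(B)`, and the numbers of points in disjoint Borel sets are independent. -/
structure IsPoissonPointProcess (T : Ω → Set ℝ) (lam : ℝ≥0) (P : Measure Ω) : Prop where
  hasLaw_count : ∀ B : Set ℝ, MeasurableSet B → volume B < ∞ →
    HasLaw (fun ω => (T ω ∩ B).encard)
      ((poissonMeasure (lam * (volume B).toNNReal)).map (fun n : ℕ => (n : ℕ∞))) P
  indep_count : ∀ (n : ℕ) (B : Fin n → Set ℝ), (∀ i, MeasurableSet (B i)) →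
    Pairwise (fun i j => Disjoint (B i) (B j)) →
    iIndepFun (fun i ω => (T ω ∩ B i).encard) P

/-- The random variables `τ n`, `n ∈ ℤ`, are the points of a Poisson point process on `ℝ` with
intensity `lam`, listed in increasing order and labelled so that `τ 0 < 0 < τ 1`. -/
structure IsPoissonPoints (τ : ℤ → Ω → ℝ) (lam : ℝ≥0) (P : Measure Ω) : Prop where
  measurable : ∀ n, Measurable (τ n)
  strictMono : ∀ᵐ ω ∂P, StrictMono (fun n => τ n ω)
  label : ∀ᵐ ω ∂P, τ 0 ω < 0 ∧ 0 < τ 1 ω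
  poisson : IsPoissonPointProcess (fun ω => range (fun n => τ n ω)) lam P

/-- `i(t) = sup {n ≥ 0 : τ_n ≤ t}`. -/
def lastIndex (τ : ℤ → Ω → ℝ) (t : ℝ) (ω : Ω) : ℕ :=
  sSup {n : ℕ | τ n ω ≤ t}

/-- The time change
`I_t = σ_{i(t)}² (t - τ_{i(t)})^{2D} + ∑_{k=1}^{i(t)} σ_{k-1}² (τ_k - τ_{k-1})^{2D}
- σ_0² (-τ_0)^{2D}`, for `t ≥ 0`. -/
def clock (D : ℝ) (τ : ℤ → Ω → ℝ) (σ : ℕ → Ω → ℝ) (t : ℝ) (ω : Ω) : ℝ :=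
  σ (lastIndex τ t ω) ω ^ 2 * (t - τ (lastIndex τ t ω) ω) ^ (2 * D)
    + ∑ k ∈ Finset.range (lastIndex τ t ω),
        σ k ω ^ 2 * (τ ((k : ℤ) + 1) ω - τ (k : ℤ) ω) ^ (2 * D)
    - σ 0 ω ^ 2 * (-τ 0 ω) ^ (2 * D)

/-- The process `X_t = W_{I_t}`, for `t ≥ 0`. Almost surely `I_t ≥ 0` for all `t ≥ 0`, so the
conversion of `I_t` to a nonnegative real is harmless. -/
def price (D : ℝ) (W : ℝ≥0 → Ω → ℝ) (τ : ℤ → Ω → ℝ) (σ : ℕ → Ω → ℝ) (t : ℝ) (ω : Ω) : ℝ :=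
  W (clock D τ σ t ω).toNNReal ω

/-- The absolute increment `|X_{t+h} - X_t|`. -/
def absIncr (D : ℝ) (W : ℝ≥0 → Ω → ℝ) (τ : ℤ → Ω → ℝ) (σ : ℕ → Ω → ℝ) (h t : ℝ) (ω : Ω) : ℝ :=
  |price D W τ σ (t + h) ω - price D W τ σ t ω|

/-- The correlation coefficient `Cov(Y, Z) / √(Var(Y) Var(Z))`. -/
def corr (Y Z : Ω → ℝ) (P : Measure Ω) : ℝ :=
  cov[Y, Z; P] / √(Var[Y; P] * Var[Z; P])

/-- The joint law of the independent variables `(σ, S)`, with `σ ∼ ν`, `S ∼ Exp(1)`. -/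
def lawσS (ν : Measure ℝ) : Measure (ℝ × ℝ) :=
  ν.prod (expMeasure 1)

/-- The joint law of the independent variables `(σ, S, W₁)`, with `σ ∼ ν`, `S ∼ Exp(1)`,
`W₁ ∼ N(0,1)`. -/
def lawσSW (ν : Measure ℝ) : Measure (ℝ × ℝ × ℝ) :=
  ν.prod ((expMeasure 1).prod (gaussianReal 0 1))

/-- The variable `σ (S + x)^{D-1/2}`, as a function of `(σ, S)`. -/
def shiftedVol (D x : ℝ) (p : ℝ × ℝ) : ℝ :=
  p.1 * (p.2 + x) ^ (D - 1 / 2)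

/-- The variable `σ |W₁| S^{D-1/2}`, as a function of `(σ, S, W₁)`. -/
def limitAbs (D : ℝ) (p : ℝ × ℝ × ℝ) : ℝ :=
  p.1 * |p.2.2| * p.2.1 ^ (D - 1 / 2)

/-- `φ(x) = Cov(σ S^{D-1/2}, σ (S + x)^{D-1/2})`. -/
def phi (D : ℝ) (ν : Measure ℝ) (x : ℝ) : ℝ :=
  cov[shiftedVol D 0, shiftedVol D x; lawσS ν]

/-- The limiting autocorrelation
`ρ(u) = 2 / (π Var(σ |W₁| S^{D-1/2})) * e^{-λ|u|} * φ(λ|u|)`. -/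
def rho (D lam : ℝ) (ν : Measure ℝ) (u : ℝ) : ℝ :=
  2 / (Real.pi * Var[limitAbs D; lawσSW ν]) * Real.exp (-lam * |u|) * phi D ν (lam * |u|)

end TimeChange

end

/-! Given the points and the volatilities, `X` is a Brownian motion run along a frozen increasing
clock `I`, so its increments are centred Gaussian with variance `ΔI`, and independent over disjoint
time intervals. Hence `E|ΔX|² = E ΔI`, `E|ΔX| = √(2/π) E√ΔI`, and over disjoint intervals
`E|ΔX_s||ΔX_t| = (2/π) E√ΔI_s√ΔI_t`. For `h` small enough the correlation is thus a function of
moments of the normalized increments `ΔI/h` (`corr_absIncr`).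

At a fixed time, almost surely not a point, `ΔI/h` converges to the density `2Dσ²·age^(2D-1)`. Only
`E σ² < ∞` is available, so the density is merely integrable and no single dominating function is at
hand. But the law of the age does not depend on time, so by Tonelli `E(ΔI/h)` equals the mean
density for every `h`; the generalized dominated convergence theorem, with `ΔI/h` in the dominating
functions, then gives the limits of the moments of `√(ΔI/h)` (`tendsto_integral_sqrt`,
`tendsto_integral_sqrt_mul`).

The limits are explicit because `λ·age` is standard exponential. For two times at rescaled distance
`u`, with probability `e^{-u}` no point separates them: the later age is the earlier one plus `u`,
and the volatility is shared. Otherwise the later age is below `u` and independent of the earlier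
one, and the volatilities are independent (`map_age_age`, `lintegral_sqrt_rate_mul`). Subtracting
the product of the means leaves `e^{-u} φ(u)` times a scale factor, which cancels against the
variances. The variances are positive because `(E|W₁|)² = 2/π < 1`. -/

namespace TimeChange

/-! ### Dominated convergence, Gaussian and exponential integrals. -/

section General

/-- A form of the generalized dominated convergence theorem: convergence of the integrals of the
dominating functions replaces their constancy. -/
lemma tendsto_integral_of_dominated_of_integral_eq {α ι : Type*} [MeasurableSpace α]
    {μ : Measure α} {l : Filter ι} [l.IsCountablyGenerated]
    {p m : ι → α → ℝ} {p₀ m₀ : α → ℝ}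
    (hp : ∀ᶠ i in l, AEStronglyMeasurable (p i) μ) (hp0 : ∀ᶠ i in l, 0 ≤ᵐ[μ] p i)
    (hpm : ∀ᶠ i in l, p i ≤ᵐ[μ] m i) (hm : ∀ᶠ i in l, Integrable (m i) μ)
    (hm₀ : Integrable m₀ μ)
    (hpl : ∀ᵐ x ∂μ, Tendsto (fun i => p i x) l (𝓝 (p₀ x)))
    (hml : ∀ᵐ x ∂μ, Tendsto (fun i => m i x) l (𝓝 (m₀ x)))
    (hint : Tendsto (fun i => ∫ x, m i x ∂μ) l (𝓝 (∫ x, m₀ x ∂μ)))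
    (hm₀0 : 0 ≤ᵐ[μ] m₀) (hp₀m₀ : p₀ ≤ᵐ[μ] m₀) :
    Tendsto (fun i => ∫ x, p i x ∂μ) l (𝓝 (∫ x, p₀ x ∂μ)) := by
  -- Truncation at `m₀`: ordinary dominated convergence applies to `min p m₀`, and the excess of `p`
  -- over `m₀` is at most that of `m`, whose integral tends to zero.
  have h1 : Tendsto (fun i => ∫ x, min (p i x) (m₀ x) ∂μ) l (𝓝 (∫ x, p₀ x ∂μ)) := by
    refine tendsto_integral_filter_of_dominated_convergence m₀ ?_ ?_ hm₀ ?_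
    · filter_upwards [hp] with i hi using hi.inf hm₀.aestronglyMeasurable
    · filter_upwards [hp0] with i hi
      filter_upwards [hi, hm₀0] with x hx hx0
      rw [Real.norm_of_nonneg (le_min hx hx0)]
      exact min_le_right _ _
    · filter_upwards [hpl, hp₀m₀] with x hx hx0
      have := hx.min (tendsto_const_nhds (x := m₀ x))
      rwa [min_eq_left hx0] at this
  have h2 : Tendsto (fun i => ∫ x, min (m i x) (m₀ x) ∂μ) l (𝓝 (∫ x, m₀ x ∂μ)) := by
    refine tendsto_integral_filter_of_dominated_convergence m₀ ?_ ?_ hm₀ ?_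
    · filter_upwards [hm] with i hi using hi.aestronglyMeasurable.inf hm₀.aestronglyMeasurable
    · filter_upwards [hp0, hpm] with i hi him
      filter_upwards [hi, him, hm₀0] with x hx hxm hx0
      rw [Real.norm_of_nonneg (le_min (le_trans hx hxm) hx0)]
      exact min_le_right _ _
    · filter_upwards [hml] with x hx
      have := hx.min (tendsto_const_nhds (x := m₀ x))
      rwa [min_self] at this
  have h3 := hint.sub h2
  rw [sub_self] at h3
  have h4 : Tendsto (fun i => ∫ x, p i x ∂μ - ∫ x, min (p i x) (m₀ x) ∂μ) l (𝓝 0) := by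
    refine tendsto_of_tendsto_of_tendsto_of_le_of_le' tendsto_const_nhds h3 ?_ ?_
    all_goals
      filter_upwards [hp, hp0, hpm, hm] with i hi hi0 him hmi
      have hpi : Integrable (p i) μ := hmi.mono' hi (by
        filter_upwards [hi0, him] with x hx hxm
        rwa [Real.norm_of_nonneg hx])
      have e1 : Integrable (fun x => min (p i x) (m₀ x)) μ := hpi.inf hm₀
      have e2 : Integrable (fun x => min (m i x) (m₀ x)) μ := hmi.inf hm₀
    · rw [sub_nonneg]
      exact integral_mono e1 hpi fun x => min_le_left _ _
    · rw [← integral_sub hpi e1, ← integral_sub hmi e2]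
      refine integral_mono_ae (hpi.sub e1) (hmi.sub e2) ?_
      filter_upwards [him] with x hx
      show p i x - min (p i x) (m₀ x) ≤ m i x - min (m i x) (m₀ x)
      -- The excess `y - min y m₀` is the positive part of `y - m₀`, hence monotone in `y`.
      rcases le_total (p i x) (m₀ x) with h | h <;> rcases le_total (m i x) (m₀ x) with h' | h' <;>
        simp only [min_eq_left, min_eq_right, h, h'] <;> linarith
  simpa using h4.add h1

/-- Second moment of the centred Gaussian law. -/
lemma lintegral_sq_gaussianReal (v : ℝ≥0) :
    ∫⁻ x, ENNReal.ofReal (x ^ 2) ∂(gaussianReal 0 v) = v := by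
  have h := variance_id_gaussianReal (μ := 0) (v := v)
  rw [variance_of_integral_eq_zero aemeasurable_id (by simp)] at h
  rw [← ofReal_integral_eq_lintegral_ofReal]
  · simp only [id] at h
    rw [h]; simp
  · exact (memLp_id_gaussianReal 2).integrable_sq
  · exact ae_of_all _ fun x => sq_nonneg x

lemma lintegral_abs_gaussianReal_one :
    ∫⁻ x, ENNReal.ofReal |x| ∂(gaussianReal 0 1) = ENNReal.ofReal (√(2 / Real.pi)) := by
  have hi : Integrable (fun x : ℝ => |x|) (gaussianReal 0 1) :=
    ((memLp_id_gaussianReal 1).integrable (by simp)).abs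
  rw [← ofReal_integral_eq_lintegral_ofReal hi (ae_of_all _ fun x => abs_nonneg x)]
  congr 1
  rw [integral_gaussianReal_eq_integral_smul one_ne_zero]
  have e : ∀ x : ℝ, gaussianPDFReal 0 1 x • |x|
      = (fun y : ℝ => (√(2 * Real.pi))⁻¹ * (y ^ (1:ℝ) * Real.exp (-(1/2) * y ^ (2:ℝ)))) |x| := by
    intro x
    simp only [gaussianPDFReal, smul_eq_mul, NNReal.coe_one, mul_one, sub_zero, Real.rpow_one,
      Real.rpow_two, sq_abs]
    rw [show -x ^ 2 / 2 = -(1/2) * x^2 by ring]; ring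
  simp_rw [e]
  rw [integral_comp_abs (f := fun y : ℝ => (√(2 * Real.pi))⁻¹ *
    (y ^ (1:ℝ) * Real.exp (-(1/2) * y ^ (2:ℝ)))), integral_const_mul,
    integral_rpow_mul_exp_neg_mul_rpow (by norm_num) (by norm_num) (by norm_num)]
  norm_num
  field_simp
  norm_num

lemma lintegral_abs_gaussianReal (v : ℝ≥0) :
    ∫⁻ x, ENNReal.ofReal |x| ∂(gaussianReal 0 v)
      = ENNReal.ofReal (√(2 / Real.pi)) * ENNReal.ofReal (√v) := by
  have h : gaussianReal 0 v = (gaussianReal 0 1).map (√v * ·) := by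
    rw [gaussianReal_map_const_mul]
    congr
    · simp
    · ext; simp
  rw [h, lintegral_map (by fun_prop) (by fun_prop)]
  simp_rw [abs_mul, ENNReal.ofReal_mul (abs_nonneg _)]
  rw [lintegral_const_mul _ (by fun_prop), lintegral_abs_gaussianReal_one,
    abs_of_nonneg (Real.sqrt_nonneg _), mul_comm]

lemma lintegral_expMeasure_one {f : ℝ → ℝ≥0∞} (hf : Measurable f) :
    ∫⁻ x, f x ∂(expMeasure 1) = ∫⁻ x in Ici 0, ENNReal.ofReal (Real.exp (-x)) * f x := by
  rw [expMeasure, gammaMeasure, lintegral_withDensity_eq_lintegral_mul _ (by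
    exact (measurable_gammaPDFReal 1 1).ennreal_ofReal) hf, ← lintegral_indicator measurableSet_Ici]
  congr 1 with x
  by_cases hx : 0 ≤ x
  · simp [gammaPDF_of_nonneg hx, indicator_of_mem (mem_Ici.2 hx)]
  · simp [gammaPDF_of_neg (not_le.1 hx), hx]

instance : IsProbabilityMeasure (expMeasure 1) := isProbabilityMeasure_expMeasure one_pos

/-- The memoryless property of the exponential law. -/
lemma setLIntegral_Ici_expMeasure_one {u : ℝ} (hu : 0 ≤ u) {f : ℝ → ℝ≥0∞} (hf : Measurable f) :
    ∫⁻ x in Ici u, f x ∂(expMeasure 1)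
      = ENNReal.ofReal (Real.exp (-u)) * ∫⁻ x, f (x + u) ∂(expMeasure 1) := by
  rw [← lintegral_indicator measurableSet_Ici,
    lintegral_expMeasure_one (hf.indicator measurableSet_Ici),
    lintegral_expMeasure_one (f := fun x => f (x + u)) (hf.comp (measurable_add_const u)),
    ← lintegral_const_mul _ (by fun_prop), ← lintegral_indicator measurableSet_Ici,
    ← lintegral_indicator measurableSet_Ici, ← lintegral_add_right_eq_self _ u]
  congr 1 with x
  by_cases hx : 0 ≤ x
  · rw [indicator_of_mem (by simp; linarith), indicator_of_mem (by simpa using hx),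
      indicator_of_mem (by simpa using hx), ← mul_assoc, ← ENNReal.ofReal_mul (Real.exp_nonneg _),
      ← Real.exp_add]
    congr 3; ring
  · rw [indicator_of_notMem (s := Ici 0) (a := x) (by simpa using hx)]
    by_cases h : x + u ∈ Ici 0
    · rw [indicator_of_mem h, indicator_of_notMem (by simpa using hx), mul_zero]
    · rw [indicator_of_notMem h]

/-- Negative `a` is included because the quadrants that determine a planar law have arbitrary real
corners. -/
lemma expMeasure_one_Ici (a : ℝ) :
    expMeasure 1 (Ici a) = ENNReal.ofReal (Real.exp (-max a 0)) := by
  rcases le_total 0 a with ha | ha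
  · have h := setLIntegral_Ici_expMeasure_one ha (f := fun _ => 1) measurable_const
    simp only [lintegral_const, Measure.restrict_apply_univ, one_mul, measure_univ, mul_one] at h
    rw [h, max_eq_left ha]
  · have h := setLIntegral_Ici_expMeasure_one le_rfl (f := fun _ => 1) measurable_const
    simp only [lintegral_const, Measure.restrict_apply_univ, one_mul, measure_univ, mul_one,
      neg_zero, Real.exp_zero, ENNReal.ofReal_one] at h
    rw [max_eq_right ha, neg_zero, Real.exp_zero, ENNReal.ofReal_one]
    exact le_antisymm prob_le_one (h ▸ measure_mono (Ici_subset_Ici.2 ha))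

lemma ae_pos_expMeasure_one : ∀ᵐ x ∂(expMeasure 1), 0 < x := by
  have hm : MeasurableSet {x : ℝ | ¬ 0 < x} := (measurableSet_lt measurable_const measurable_id).compl
  rw [ae_iff, ← lintegral_indicator_one hm,
    lintegral_expMeasure_one (measurable_one.indicator hm), ← setLIntegral_congr Ioi_ae_eq_Ici]
  refine setLIntegral_eq_zero measurableSet_Ioi fun x hx => ?_
  rw [indicator_of_notMem (by simpa using hx)]; simp

lemma integrable_rpow_expMeasure_one {a : ℝ} (ha : 0 < a) :
    Integrable (fun s : ℝ => s ^ (a - 1)) (expMeasure 1) := by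
  refine ⟨(measurable_id.pow_const _).aestronglyMeasurable, ?_⟩
  rw [HasFiniteIntegral, lintegral_expMeasure_one (by fun_prop), ← setLIntegral_congr Ioi_ae_eq_Ici]
  have h := (Real.GammaIntegral_convergent ha).2
  refine lt_of_le_of_lt (le_of_eq ?_) h
  refine setLIntegral_congr_fun measurableSet_Ioi fun x hx => ?_
  simp only [enorm_mul]
  rw [Real.enorm_of_nonneg (Real.exp_nonneg _)]

/-- Two finite measures on the plane agree if they agree on closed upper right quadrants. -/
lemma ext_of_Ici_prod {μ ν : Measure (ℝ × ℝ)} [IsFiniteMeasure μ]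
    (h : ∀ a b, μ (Ici a ×ˢ Ici b) = ν (Ici a ×ˢ Ici b)) : μ = ν := by
  have hspan : IsCountablySpanning (range (Ici : ℝ → Set ℝ)) := by
    refine ⟨fun n : ℕ => Ici (-(n : ℝ)), fun n => mem_range_self _, ?_⟩
    refine eq_univ_of_forall fun x => ?_
    obtain ⟨n, hn⟩ := exists_nat_ge (-x)
    exact mem_iUnion.2 ⟨n, by simp only [mem_Ici]; linarith⟩
  have hgen : (Prod.instMeasurableSpace : MeasurableSpace (ℝ × ℝ)) =
      MeasurableSpace.generateFrom (image2 (· ×ˢ ·) (range (Ici : ℝ → Set ℝ)) (range Ici)) := by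
    have hb : MeasurableSpace.generateFrom (range (Ici : ℝ → Set ℝ)) = Real.measurableSpace := by
      rw [← borel_eq_generateFrom_Ici, BorelSpace.measurable_eq (α := ℝ)]
    exact (generateFrom_eq_prod hb hb hspan hspan).symm
  refine Measure.ext_of_generateFrom_of_iUnion _ (fun n : ℕ => Ici (-(n : ℝ)) ×ˢ Ici (-(n : ℝ))) hgen
    (isPiSystem_Ici.prod isPiSystem_Ici) ?_ ?_ ?_ ?_
  · refine eq_univ_of_forall fun x => ?_
    obtain ⟨n, hn⟩ := exists_nat_ge (max (-x.1) (-x.2))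
    refine mem_iUnion.2 ⟨n, ?_⟩
    have := le_trans (le_max_left _ _) hn
    have := le_trans (le_max_right _ _) hn
    simp only [mem_prod, mem_Ici]; constructor <;> linarith
  · exact fun n => ⟨_, mem_range_self _, _, mem_range_self _, rfl⟩
  · exact fun n => measure_ne_top _ _
  · rintro _ ⟨_, ⟨a, rfl⟩, _, ⟨b, rfl⟩, rfl⟩
    exact h a b

end General

/-! ### Pathwise analysis of the clock and its density. -/

section Path

variable {Ω : Type*} {D : ℝ} {τ : ℤ → Ω → ℝ} {σ : ℕ → Ω → ℝ} {ω : Ω}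

/-- The points `τ n ω` are increasing, correctly labelled, and leave every bounded set. -/
structure IsGoodPath (τ : ℤ → Ω → ℝ) (ω : Ω) : Prop where
  strictMono : StrictMono (fun n => τ n ω)
  zero_neg : τ 0 ω < 0
  one_pos : 0 < τ 1 ω
  unbounded : ∀ t, ∃ n : ℕ, t < τ n ω

lemma IsGoodPath.lastIndex_spec (hg : IsGoodPath τ ω) {t : ℝ} (ht : 0 ≤ t) :
    τ (lastIndex τ t ω) ω ≤ t ∧ t < τ ((lastIndex τ t ω : ℤ) + 1) ω := by
  obtain ⟨N, hN⟩ := hg.unbounded t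
  -- Boundedness ensures that the supremum is attained rather than the default value `0` of `sSup`
  -- on `ℕ`.
  have hb : BddAbove {n : ℕ | τ n ω ≤ t} := by
    refine ⟨N, fun n hn => ?_⟩
    have h := hg.strictMono.lt_iff_lt.1 (lt_of_le_of_lt hn hN)
    exact_mod_cast h.le
  have hne : {n : ℕ | τ n ω ≤ t}.Nonempty := ⟨0, by
    simpa using (hg.zero_neg.le.trans ht)⟩
  refine ⟨Nat.sSup_mem hne hb, ?_⟩
  by_contra! h
  have h2 : lastIndex τ t ω + 1 ∈ {n : ℕ | τ n ω ≤ t} := by simpa using h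
  have h3 := le_csSup hb h2
  change lastIndex τ t ω + 1 ≤ lastIndex τ t ω at h3
  omega

lemma IsGoodPath.lastIndex_eq (hg : IsGoodPath τ ω) {t : ℝ} (ht : 0 ≤ t) {n : ℕ}
    (h1 : τ n ω ≤ t) (h2 : t < τ ((n : ℤ) + 1) ω) : lastIndex τ t ω = n := by
  obtain ⟨h3, h4⟩ := hg.lastIndex_spec ht
  have h5 := hg.strictMono.lt_iff_lt.1 (lt_of_le_of_lt h1 h4)
  have h6 := hg.strictMono.lt_iff_lt.1 (lt_of_le_of_lt h3 h2)
  omega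

lemma IsGoodPath.lastIndex_mono (hg : IsGoodPath τ ω) {s t : ℝ} (hs : 0 ≤ s) (hst : s ≤ t) :
    lastIndex τ s ω ≤ lastIndex τ t ω := by
  have h1 := (hg.lastIndex_spec hs).1
  have h2 := (hg.lastIndex_spec (hs.trans hst)).2
  have h3 := hg.strictMono.lt_iff_lt.1 (lt_of_le_of_lt (h1.trans hst) h2)
  omega

/-- The time elapsed at `t` since the last point. -/
noncomputable def age (τ : ℤ → Ω → ℝ) (t : ℝ) (ω : Ω) : ℝ := t - τ (lastIndex τ t ω) ω

/-- The density of the time change. -/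
noncomputable def rate (D : ℝ) (τ : ℤ → Ω → ℝ) (σ : ℕ → Ω → ℝ) (t : ℝ) (ω : Ω) : ℝ :=
  2 * D * (σ (lastIndex τ t ω) ω ^ 2 * age τ t ω ^ (2 * D - 1))

lemma IsGoodPath.age_nonneg (hg : IsGoodPath τ ω) {t : ℝ} (ht : 0 ≤ t) : 0 ≤ age τ t ω :=
  sub_nonneg.2 (hg.lastIndex_spec ht).1

lemma IsGoodPath.rate_nonneg (hg : IsGoodPath τ ω) (hD : 0 < D) {t : ℝ} (ht : 0 ≤ t) :
    0 ≤ rate D τ σ t ω := by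
  have := Real.rpow_nonneg (hg.age_nonneg ht) (2 * D - 1)
  unfold rate
  positivity

lemma clock_sub_of_lastIndex_eq {a b : ℝ} (h : lastIndex τ a ω = lastIndex τ b ω) :
    clock D τ σ b ω - clock D τ σ a ω = σ (lastIndex τ a ω) ω ^ 2 *
      ((b - τ (lastIndex τ a ω) ω) ^ (2 * D) - (a - τ (lastIndex τ a ω) ω) ^ (2 * D)) := by
  unfold clock
  rw [← h]; ring

/-- At the next point the running term has just become a summand and the new running term is
`0^(2D)`, which vanishes since `2D > 0`: the clock is continuous across a point. -/
lemma clock_sub_of_lastIndex_succ (hD : 0 < D) {a c : ℝ}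
    (h : lastIndex τ c ω = lastIndex τ a ω + 1) (hc : c = τ ((lastIndex τ a ω : ℤ) + 1) ω) :
    clock D τ σ c ω - clock D τ σ a ω = σ (lastIndex τ a ω) ω ^ 2 *
      ((c - τ (lastIndex τ a ω) ω) ^ (2 * D) - (a - τ (lastIndex τ a ω) ω) ^ (2 * D)) := by
  unfold clock
  rw [h, Finset.sum_range_succ]
  push_cast
  rw [← hc, sub_self, Real.zero_rpow (by positivity)]; ring

lemma clock_zero (hg : IsGoodPath τ ω) : clock D τ σ 0 ω = 0 := by
  have h : lastIndex τ 0 ω = 0 :=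
    hg.lastIndex_eq le_rfl (by simpa using hg.zero_neg.le) (by simpa using hg.one_pos)
  simp [clock, h]

/-- The exponent `2D - 1` exceeds `-1`, so the singularity at `c` is integrable. -/
lemma lintegral_rpow_sub {c a b : ℝ} (hD : 0 < D) (hca : c ≤ a) (hab : a ≤ b) (v : ℝ) :
    ∫⁻ u in Ioc a b, ENNReal.ofReal (2 * D * (v ^ 2 * (u - c) ^ (2 * D - 1)))
      = ENNReal.ofReal (v ^ 2 * ((b - c) ^ (2 * D) - (a - c) ^ (2 * D))) := by
  have hi : IntervalIntegrable (fun u => (u - c) ^ (2 * D - 1)) volume a b := by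
    have := (intervalIntegral.intervalIntegrable_rpow' (a := a - c) (b := b - c)
      (show -1 < 2 * D - 1 by linarith)).comp_sub_right c
    simpa using this
  have hi' := (hi.const_mul (v ^ 2)).const_mul (2 * D)
  rw [← ofReal_integral_eq_lintegral_ofReal]
  · congr 1
    rw [← intervalIntegral.integral_of_le hab, intervalIntegral.integral_const_mul,
      intervalIntegral.integral_const_mul,
      intervalIntegral.integral_comp_sub_right (fun u => u ^ (2 * D - 1)) c,
      integral_rpow (Or.inl (by linarith))]
    rw [sub_add_cancel]
    field_simp
  · exact (intervalIntegrable_iff_integrableOn_Ioc_of_le hab).1 hi'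
  · refine (ae_restrict_iff' measurableSet_Ioc).2 (ae_of_all _ fun u hu => ?_)
    have := Real.rpow_nonneg (show 0 ≤ u - c by linarith [hu.1]) (2 * D - 1)
    show 0 ≤ 2 * D * (v ^ 2 * (u - c) ^ (2 * D - 1))
    positivity

/-- Induction on the number of points in `(a, b]`, cutting at the first one. Monotonicity is proved
along with the integral formula, since adding the pieces inside `ENNReal.ofReal` needs their signs.
-/
lemma IsGoodPath.lintegral_rate_aux (hg : IsGoodPath τ ω) (hD : 0 < D) (m : ℕ) :
    ∀ a b : ℝ, 0 ≤ a → a ≤ b → lastIndex τ b ω = lastIndex τ a ω + m →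
      clock D τ σ a ω ≤ clock D τ σ b ω ∧
      ∫⁻ u in Ioc a b, ENNReal.ofReal (rate D τ σ u ω)
        = ENNReal.ofReal (clock D τ σ b ω - clock D τ σ a ω) := by
  have hpow : ∀ a b : ℝ, 0 ≤ a → a ≤ b → 0 ≤ σ (lastIndex τ a ω) ω ^ 2 *
      ((b - τ (lastIndex τ a ω) ω) ^ (2 * D) - (a - τ (lastIndex τ a ω) ω) ^ (2 * D)) := by
    intro a b ha hab
    refine mul_nonneg (sq_nonneg _) (sub_nonneg.2 ?_)
    have := hg.age_nonneg ha
    unfold age at this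
    exact Real.rpow_le_rpow this (by linarith) (by positivity)
  induction m with
  | zero =>
    intro a b ha hab h
    rw [add_zero] at h
    rw [← sub_nonneg, clock_sub_of_lastIndex_eq h.symm]
    refine ⟨hpow a b ha hab, ?_⟩
    rw [← lintegral_rpow_sub hD (hg.lastIndex_spec ha).1 hab]
    refine setLIntegral_congr_fun measurableSet_Ioc fun u hu => ?_
    have h1 := hg.lastIndex_mono ha hu.1.le
    have h2 := hg.lastIndex_mono (ha.trans hu.1.le) hu.2
    have h3 : lastIndex τ u ω = lastIndex τ a ω := by omega
    simp only [rate, age, h3]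
  | succ m ih =>
    intro a b ha hab h
    obtain ⟨c, hc⟩ : ∃ c, c = τ ((lastIndex τ a ω : ℤ) + 1) ω := ⟨_, rfl⟩
    have hac : a < c := hc ▸ (hg.lastIndex_spec ha).2
    have hcb : c ≤ b := by
      refine le_trans ?_ (hg.lastIndex_spec (ha.trans hab)).1
      rw [hc]
      exact hg.strictMono.monotone (by rw [h]; push_cast; omega)
    have hic : lastIndex τ c ω = lastIndex τ a ω + 1 := by
      refine hg.lastIndex_eq (ha.trans hac.le) ?_ ?_
      · rw [hc]; push_cast; exact le_rfl
      · rw [hc]; exact hg.strictMono (by push_cast; omega)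
    obtain ⟨ih1, ih2⟩ := ih c b (ha.trans hac.le) hcb (by omega)
    have hcl := clock_sub_of_lastIndex_succ (D := D) (σ := σ) hD hic hc
    have hle : 0 ≤ clock D τ σ c ω - clock D τ σ a ω := hcl ▸ hpow a c ha hac.le
    refine ⟨by linarith, ?_⟩
    rw [← Ioc_union_Ioc_eq_Ioc hac.le hcb, lintegral_union measurableSet_Ioc
      (Ioc_disjoint_Ioc_of_le le_rfl), ih2,
      show clock D τ σ b ω - clock D τ σ a ω = (clock D τ σ c ω - clock D τ σ a ω)
        + (clock D τ σ b ω - clock D τ σ c ω) by ring,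
      ENNReal.ofReal_add hle (by linarith)]
    congr 1
    -- The index jumps at `c` itself, so the integrands agree only on the open interval.
    rw [hcl, ← lintegral_rpow_sub hD (hg.lastIndex_spec ha).1 hac.le,
      setLIntegral_congr (Ioo_ae_eq_Ioc (a := a) (b := c)).symm,
      setLIntegral_congr (Ioo_ae_eq_Ioc (a := a) (b := c)).symm]
    refine setLIntegral_congr_fun measurableSet_Ioo fun u hu => ?_
    have h3 : lastIndex τ u ω = lastIndex τ a ω :=
      hg.lastIndex_eq (ha.trans hu.1.le) ((hg.lastIndex_spec ha).1.trans hu.1.le) (hc ▸ hu.2)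
    simp only [rate, age, h3]

lemma IsGoodPath.clock_mono (hg : IsGoodPath τ ω) (hD : 0 < D) {a b : ℝ} (ha : 0 ≤ a)
    (hab : a ≤ b) : clock D τ σ a ω ≤ clock D τ σ b ω :=
  (hg.lintegral_rate_aux hD (lastIndex τ b ω - lastIndex τ a ω) a b ha hab
    (by have := hg.lastIndex_mono ha hab; omega)).1

lemma IsGoodPath.lintegral_rate (hg : IsGoodPath τ ω) (hD : 0 < D) {a b : ℝ} (ha : 0 ≤ a)
    (hab : a ≤ b) : ∫⁻ u in Ioc a b, ENNReal.ofReal (rate D τ σ u ω)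
        = ENNReal.ofReal (clock D τ σ b ω - clock D τ σ a ω) :=
  (hg.lintegral_rate_aux hD (lastIndex τ b ω - lastIndex τ a ω) a b ha hab
    (by have := hg.lastIndex_mono ha hab; omega)).2

lemma IsGoodPath.clock_nonneg (hg : IsGoodPath τ ω) (hD : 0 < D) {a : ℝ} (ha : 0 ≤ a) :
    0 ≤ clock D τ σ a ω :=
  clock_zero (D := D) (σ := σ) hg ▸ hg.clock_mono hD le_rfl ha

/-- Away from the points the index is constant just to the right of `t`, and the age is positive, so
the power is differentiable even though `2D` may be below `1`. -/
lemma IsGoodPath.tendsto_clock (hg : IsGoodPath τ ω) {t : ℝ} (ht : 0 ≤ t)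
    (hne : ∀ n, τ n ω ≠ t) :
    Tendsto (fun h => (clock D τ σ (t + h) ω - clock D τ σ t ω) / h) (𝓝[>] 0)
      (𝓝 (rate D τ σ t ω)) := by
  obtain ⟨h1, h2⟩ := hg.lastIndex_spec ht
  obtain ⟨i, hi⟩ : ∃ i, i = lastIndex τ t ω := ⟨_, rfl⟩
  have hpos : 0 < t - τ i ω := sub_pos.2 (hi ▸ lt_of_le_of_ne h1 (hne _))
  have hd : HasDerivAt (fun x => σ i ω ^ 2 * (x - τ i ω) ^ (2 * D))
      (rate D τ σ t ω) t := by
    have := ((((hasDerivAt_id t).sub_const (τ i ω)).rpow_const (p := 2 * D)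
      (Or.inl hpos.ne')).const_mul (σ i ω ^ 2))
    refine this.congr_deriv ?_
    simp only [rate, age, ← hi, id]; ring
  have hs := (hasDerivAt_iff_tendsto_slope_zero.1 hd).mono_left
    (nhdsWithin_mono (0 : ℝ) (t := {0}ᶜ) (s := Ioi 0) fun x hx => (ne_of_gt hx))
  refine hs.congr' ?_
  have hev : ∀ᶠ h in 𝓝[>] (0 : ℝ), h < τ ((i : ℤ) + 1) ω - t :=
    nhdsWithin_le_nhds (Iio_mem_nhds (by rw [hi]; linarith))
  filter_upwards [hev, self_mem_nhdsWithin] with h hh hh0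
  have hh0 : 0 < h := hh0
  have hl : lastIndex τ t ω = lastIndex τ (t + h) ω := by
    rw [← hi]
    exact (hg.lastIndex_eq (by linarith) (by rw [hi]; linarith) (by linarith)).symm
  rw [clock_sub_of_lastIndex_eq hl, ← hi, smul_eq_mul]
  ring

end Path

/-! ### Measurability of the index, the age, the density and the clock. -/

section Measurability

lemma measurable_nat_sSup {α : Type*} [MeasurableSpace α] {p : ℕ → α → Prop}
    (hp : ∀ n, MeasurableSet {x | p n x}) : Measurable fun x => sSup {n : ℕ | p n x} := by
  classical
  -- A supremum over a random set becomes a countable supremum of measurable functions.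
  have h : (fun x => sSup {n : ℕ | p n x}) = fun x => ⨆ n, if p n x then n else 0 := by
    ext x
    by_cases hb : BddAbove {n : ℕ | p n x}
    · have hb' : BddAbove (range fun n : ℕ => if p n x then n else 0) := by
        obtain ⟨N, hN⟩ := hb
        refine ⟨N, ?_⟩
        rintro _ ⟨n, rfl⟩
        dsimp only
        split_ifs with h
        exacts [hN h, Nat.zero_le _]
      apply le_antisymm
      · rcases eq_empty_or_nonempty {n : ℕ | p n x} with he | hne
        · simp [he]
        · refine csSup_le hne fun n hn => ?_
          have := le_ciSup hb' n
          simpa only [if_pos (show p n x from hn)] using this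
      · refine ciSup_le fun n => ?_
        split_ifs with h
        exacts [le_csSup hb h, Nat.zero_le _]
    -- In the unbounded case both sides take the default value `0`.
    · rw [Nat.sSup_of_not_bddAbove hb, iSup, Nat.sSup_of_not_bddAbove]
      rintro ⟨N, hN⟩
      refine hb ⟨N, fun n hn => ?_⟩
      have := hN (mem_range_self n)
      simpa only [if_pos (show p n x from hn)] using this
  rw [h]
  exact Measurable.iSup fun n => Measurable.ite (hp n) measurable_const measurable_const

variable {Ω : Type*} [MeasurableSpace Ω] {D : ℝ} {τ : ℤ → Ω → ℝ} {σ : ℕ → Ω → ℝ}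

/-- Joint measurability in time and randomness is needed for the Tonelli argument on the density. -/
lemma measurable_lastIndex_uncurry (hτ : ∀ n, Measurable (τ n)) :
    Measurable fun p : ℝ × Ω => lastIndex τ p.1 p.2 :=
  measurable_nat_sSup fun n => measurableSet_le ((hτ n).comp measurable_snd) measurable_fst

lemma measurable_lastIndex (hτ : ∀ n, Measurable (τ n)) (t : ℝ) : Measurable (lastIndex τ t) :=
  (measurable_lastIndex_uncurry hτ).comp (measurable_const.prodMk measurable_id)

lemma measurable_apply_index {α : Type*} [MeasurableSpace α] {N : α → ℕ} (hN : Measurable N)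
    {f : ℕ → α → ℝ} (hf : ∀ n, Measurable (f n)) : Measurable fun x => f (N x) x := by
  have h : Measurable fun p : ℕ × α => f p.1 p.2 := measurable_from_prod_countable_right hf
  exact h.comp (hN.prodMk measurable_id)

lemma measurable_age_uncurry (hτ : ∀ n, Measurable (τ n)) :
    Measurable fun p : ℝ × Ω => age τ p.1 p.2 :=
  measurable_fst.sub (measurable_apply_index (measurable_lastIndex_uncurry hτ)
    (f := fun n p => τ n p.2) fun n => (hτ n).comp measurable_snd)

lemma measurable_age (hτ : ∀ n, Measurable (τ n)) (t : ℝ) : Measurable (age τ t) :=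
  (measurable_age_uncurry hτ).comp (measurable_const.prodMk measurable_id)

lemma measurable_rate_uncurry (hτ : ∀ n, Measurable (τ n)) (hσ : ∀ n, Measurable (σ n)) :
    Measurable fun p : ℝ × Ω => rate D τ σ p.1 p.2 := by
  have h1 := measurable_apply_index (measurable_lastIndex_uncurry hτ)
    (f := fun n p => σ n p.2) fun n => (hσ n).comp measurable_snd
  exact ((h1.pow_const 2).mul ((measurable_age_uncurry hτ).pow_const _)).const_mul _

lemma measurable_rate (hτ : ∀ n, Measurable (τ n)) (hσ : ∀ n, Measurable (σ n)) (t : ℝ) :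
    Measurable (rate D τ σ t) :=
  (measurable_rate_uncurry hτ hσ).comp (measurable_const.prodMk measurable_id)

lemma measurable_clock (hτ : ∀ n, Measurable (τ n)) (hσ : ∀ n, Measurable (σ n)) (t : ℝ) :
    Measurable (clock D τ σ t) := by
  have hi := measurable_lastIndex hτ t
  refine Measurable.sub (Measurable.add ?_ ?_) ?_
  · exact measurable_apply_index hi (f := fun n ω => σ n ω ^ 2 * (t - τ n ω) ^ (2 * D))
      fun n => ((hσ n).pow_const 2).mul ((measurable_const.sub (hτ n)).pow_const _)
  · exact measurable_apply_index hi (f := fun n ω => ∑ k ∈ Finset.range n,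
        σ k ω ^ 2 * (τ ((k : ℤ) + 1) ω - τ (k : ℤ) ω) ^ (2 * D))
      fun n => Finset.measurable_sum _ fun k _ =>
        ((hσ k).pow_const 2).mul (((hτ _).sub (hτ _)).pow_const _)
  · exact ((hσ 0).pow_const 2).mul ((hτ 0).neg.pow_const _)

end Measurability

/-! ### Ages as void events of the point process. -/

section Age

variable {Ω : Type*} {τ : ℤ → Ω → ℝ}

/-- Turns ages into events whose Poisson probability is immediate, so the laws of the individual
points are never needed. Points of negative index do no harm: they lie below the last point. -/
lemma IsGoodPath.le_age_iff {ω : Ω} (hg : IsGoodPath τ ω) {t : ℝ} (ht : 0 ≤ t) (a : ℝ) :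
    a ≤ age τ t ω ↔ range (fun n => τ n ω) ∩ Ioc (t - a) t = ∅ := by
  obtain ⟨h1, h2⟩ := hg.lastIndex_spec ht
  constructor
  · intro h
    rw [eq_empty_iff_forall_notMem]
    rintro _ ⟨⟨n, rfl⟩, h3, h4⟩
    dsimp only at h3 h4
    have h5 := hg.strictMono.lt_iff_lt.1 (lt_of_le_of_lt h4 h2)
    have h6 : τ n ω ≤ τ (lastIndex τ t ω) ω := hg.strictMono.monotone (by omega)
    unfold age at h
    linarith
  · intro h
    by_contra! hc
    unfold age at hc
    exact (eq_empty_iff_forall_notMem.1 h (τ (lastIndex τ t ω) ω))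
      ⟨mem_range_self (lastIndex τ t ω : ℤ), by linarith, h1⟩

/-- Ages at two times coincide up to the time difference exactly if there is no point between. -/
lemma IsGoodPath.lastIndex_eq_iff {ω : Ω} (hg : IsGoodPath τ ω) {s t : ℝ} (hs : 0 ≤ s)
    (hst : s ≤ t) : lastIndex τ s ω = lastIndex τ t ω ↔ t - s ≤ age τ t ω := by
  obtain ⟨h1, h2⟩ := hg.lastIndex_spec hs
  obtain ⟨h3, h4⟩ := hg.lastIndex_spec (hs.trans hst)
  unfold age
  constructor
  · intro h; rw [← h]; linarith
  · intro h
    exact hg.lastIndex_eq hs (by linarith) (lt_of_le_of_lt hst h4)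

end Age

/-! ### Laws of the ages of a Poisson process. -/

section PoissonPoints

variable {Ω : Type*} [MeasurableSpace Ω] {P : Measure Ω} {τ : ℤ → Ω → ℝ} {lam : ℝ≥0}

lemma IsPoissonPointProcess.measure_inter_eq_empty {T : Ω → Set ℝ}
    (hT : IsPoissonPointProcess T lam P) {B : Set ℝ} (hB : MeasurableSet B) (hB' : volume B < ∞) :
    P {ω | T ω ∩ B = ∅} = ENNReal.ofReal (Real.exp (-(lam * (volume B).toReal))) := by
  have h := (hT.hasLaw_count B hB hB').measure_eq (p := fun n => n = 0) (measurableSet_singleton 0)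
  have e : (fun n : ℕ => (n : ℕ∞)) ⁻¹' {x | x = 0} = {0} := by ext; simp
  rw [Measure.map_apply measurable_from_top (show MeasurableSet {x : ℕ∞ | x = 0} from
    measurableSet_singleton 0), e,
    poissonMeasure_singleton] at h
  simp only [encard_eq_zero] at h
  rw [h]
  simp [ENNReal.coe_toNNReal_eq_toReal]

lemma IsPoissonPointProcess.ae_finite {T : Ω → Set ℝ}
    (hT : IsPoissonPointProcess T lam P) {B : Set ℝ} (hB : MeasurableSet B) (hB' : volume B < ∞) :
    ∀ᵐ ω ∂P, (T ω ∩ B).Finite := by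
  have h := (hT.hasLaw_count B hB hB').measure_eq (p := fun n => n = ⊤) (measurableSet_singleton ⊤)
  have e : (fun n : ℕ => (n : ℕ∞)) ⁻¹' {x | x = ⊤} = ∅ := by ext; simp
  rw [Measure.map_apply measurable_from_top (show MeasurableSet {x : ℕ∞ | x = ⊤} from
    measurableSet_singleton ⊤), e, measure_empty] at h
  rw [ae_iff]
  simp only [encard_eq_top_iff] at h
  exact h

/-- Only unboundedness needs an argument: bounded positive points would put infinitely many of them
in some `(0, N]`, against local finiteness. -/
lemma IsPoissonPoints.ae_isGoodPath (hτ : IsPoissonPoints τ lam P) :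
    ∀ᵐ ω ∂P, IsGoodPath τ ω := by
  have h : ∀ᵐ ω ∂P, ∀ N : ℕ, (range (fun n => τ n ω) ∩ Ioc 0 (N : ℝ)).Finite :=
    ae_all_iff.2 fun N => hτ.poisson.ae_finite measurableSet_Ioc (by simp)
  filter_upwards [hτ.strictMono, hτ.label, h] with ω h1 h2 h3
  refine ⟨h1, h2.1, h2.2, fun t => ?_⟩
  by_contra! hc
  obtain ⟨N, hN⟩ := exists_nat_ge t
  refine (h3 N).not_infinite ((infinite_range_of_injective (f := fun n : ℕ => τ ((n : ℤ) + 1) ω)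
    fun a b hab => ?_).mono ?_)
  · have := h1.injective hab; omega
  · rintro _ ⟨n, rfl⟩
    refine ⟨mem_range_self _, h2.2.trans_le (h1.monotone (by omega)), le_trans ?_ hN⟩
    have := hc (n + 1)
    push_cast at this
    exact this

/-- The number of points in the null set `{t}` is Poisson with mean zero. -/
lemma IsPoissonPoints.ae_ne [IsProbabilityMeasure P] (hτ : IsPoissonPoints τ lam P) (t : ℝ) :
    ∀ᵐ ω ∂P, ∀ n, τ n ω ≠ t := by
  have h1 := hτ.poisson.hasLaw_count {t} (measurableSet_singleton t) (by simp)
  have h2 := h1.measure_eq (p := fun n => n ≠ 0) (measurableSet_singleton 0).compl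
  have e : (fun n : ℕ => (n : ℕ∞)) ⁻¹' {x | x ≠ 0} = {0}ᶜ := by ext; simp
  rw [Measure.map_apply measurable_from_top (show MeasurableSet {x : ℕ∞ | x ≠ 0} from
      (measurableSet_singleton 0).compl), e,
    prob_compl_eq_one_sub (measurableSet_singleton 0), poissonMeasure_singleton] at h2
  simp only [Real.volume_singleton, ENNReal.toNNReal_zero, mul_zero, NNReal.coe_zero, neg_zero,
    Real.exp_zero, pow_zero, mul_one, Nat.factorial_zero, Nat.cast_one, div_one,
    ENNReal.ofReal_one, tsub_self] at h2
  filter_upwards [show ∀ᵐ ω ∂P, (range (fun n => τ n ω) ∩ {t}).encard = 0 by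
    rw [ae_iff]; exact h2] with ω hω n hn
  rw [encard_eq_zero] at hω
  exact notMem_empty t (hω ▸ ⟨⟨n, hn⟩, rfl⟩)

/-- If `b ≤ t - s` the intervals are disjoint; otherwise the second reaches below `s` and the union
is a single interval ending at `t`. -/
lemma volume_Ioc_union_Ioc {s t : ℝ} (hst : s ≤ t) (a b : ℝ) :
    (volume (Ioc (s - a) s ∪ Ioc (t - b) t)).toReal
      = if b ≤ t - s then max a 0 + max b 0 else max (a + (t - s)) b := by
  split_ifs with h
  · rw [measure_union (Ioc_disjoint_Ioc_of_le (by linarith)) measurableSet_Ioc,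
      ENNReal.toReal_add (by simp) (by simp)]
    simp [Real.volume_Ioc, ENNReal.toReal_ofReal']
  · have e : Ioc (s - a) s ∪ Ioc (t - b) t = Ioc (min (s - a) (t - b)) t := by
      ext x
      simp only [mem_union, mem_Ioc, min_lt_iff]
      constructor
      · rintro (h | h)
        · exact ⟨Or.inl h.1, h.2.trans hst⟩
        · exact ⟨Or.inr h.1, h.2⟩
      · rintro ⟨h1 | h1, h2⟩
        · rcases le_or_gt x s with h3 | h3
          · exact Or.inl ⟨h1, h3⟩
          · exact Or.inr ⟨by linarith, h2⟩
        · exact Or.inr ⟨h1, h2⟩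
    rw [e, Real.volume_Ioc, ENNReal.toReal_ofReal, max_comm]
    · rcases le_total (s - a) (t - b) with h' | h'
      · rw [min_eq_left h', max_eq_right (by linarith)]; ring
      · rw [min_eq_right h', max_eq_left (by linarith)]; ring
    · have := min_le_right (s - a) (t - b)
      linarith

/-- The map which turns two independent standard exponential variables into the rescaled ages of
a Poisson process at two times at (rescaled) distance `u`. -/
noncomputable def agePair (u : ℝ) (p : ℝ × ℝ) : ℝ × ℝ := (p.1, if p.2 < u then p.2 else p.1 + u)

lemma measurable_agePair (u : ℝ) : Measurable (agePair u) :=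
  measurable_fst.prodMk (Measurable.ite (measurableSet_lt measurable_snd measurable_const)
    measurable_snd (measurable_fst.add_const u))

lemma map_agePair_Ici {u : ℝ} (hu : 0 ≤ u) (a b : ℝ) :
    ((expMeasure 1).prod (expMeasure 1)).map (agePair u) (Ici a ×ˢ Ici b)
      = ENNReal.ofReal (Real.exp
          (-(if b ≤ u then max a 0 + max b 0 else max (a + u) b))) := by
  rw [Measure.map_apply (measurable_agePair u) (measurableSet_Ici.prod measurableSet_Ici)]
  have hpos : ∀ᵐ p ∂((expMeasure 1).prod (expMeasure 1)), 0 < p.1 :=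
    Measure.quasiMeasurePreserving_fst.ae ae_pos_expMeasure_one
  split_ifs with h
  -- For `b ≤ u` both branches of the second coordinate say `b ≤ p.2` almost surely: when `u ≤ p.2`,
  -- also `p.1 + u ≥ b`, because `p.1 > 0`.
  · rw [measure_congr (t := Ici a ×ˢ Ici b), Measure.prod_prod, expMeasure_one_Ici,
      expMeasure_one_Ici, ← ENNReal.ofReal_mul (Real.exp_nonneg _), ← Real.exp_add, neg_add]
    refine eventuallyEq_set.2 ?_
    filter_upwards [hpos] with p hp
    simp only [agePair, mem_preimage, mem_prod, mem_Ici]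
    split_ifs with h2
    · rfl
    · constructor <;> rintro ⟨h3, h4⟩ <;> exact ⟨h3, by linarith⟩
  · push Not at h
    -- For `b > u` the branch `p.2 < u` is impossible, which leaves a product event.
    have e : agePair u ⁻¹' (Ici a ×ˢ Ici b) = Ici (max a (b - u)) ×ˢ Ici u := by
      ext p
      simp only [agePair, mem_preimage, mem_prod, mem_Ici, max_le_iff]
      split_ifs with h2
      · constructor
        · rintro ⟨h3, h4⟩; linarith
        · rintro ⟨h3, h4⟩; linarith
      · constructor
        · rintro ⟨h3, h4⟩; exact ⟨⟨h3, by linarith⟩, by linarith⟩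
        · rintro ⟨⟨h3, h5⟩, h4⟩; exact ⟨h3, by linarith⟩
    rw [e, Measure.prod_prod, expMeasure_one_Ici, expMeasure_one_Ici,
      ← ENNReal.ofReal_mul (Real.exp_nonneg _), ← Real.exp_add, max_eq_left hu,
      max_eq_left (le_trans (by linarith) (le_max_right _ _)), ← neg_add, max_add,
      sub_add_cancel]

/-- The joint law of the ages of the Poisson process at two times. -/
theorem IsPoissonPoints.map_age_age [IsProbabilityMeasure P] (hτ : IsPoissonPoints τ lam P)
    (hlam : 0 < lam) {s t : ℝ} (hs : 0 ≤ s) (hst : s ≤ t) :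
    P.map (fun ω => (lam * age τ s ω, lam * age τ t ω))
      = ((expMeasure 1).prod (expMeasure 1)).map (agePair (lam * (t - s))) := by
  have hm : Measurable fun ω => ((lam : ℝ) * age τ s ω, (lam : ℝ) * age τ t ω) :=
    ((measurable_age hτ.measurable s).const_mul _).prodMk
      ((measurable_age hτ.measurable t).const_mul _)
  have hl : (0 : ℝ) < lam := by exact_mod_cast hlam
  have := Measure.isProbabilityMeasure_map (μ := P) hm.aemeasurable
  refine ext_of_Ici_prod fun a b => ?_
  rw [map_agePair_Ici (mul_nonneg hl.le (sub_nonneg.2 hst)),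
    Measure.map_apply hm (measurableSet_Ici.prod measurableSet_Ici)]
  -- Both ages are large exactly when the union of two intervals contains no point, so a single void
  -- probability gives the joint tail.
  have e : (fun ω => ((lam : ℝ) * age τ s ω, (lam : ℝ) * age τ t ω)) ⁻¹' (Ici a ×ˢ Ici b)
      =ᵐ[P] {ω | range (fun n => τ n ω) ∩ (Ioc (s - a / lam) s ∪ Ioc (t - b / lam) t) = ∅} := by
    refine eventuallyEq_set.2 ?_
    filter_upwards [hτ.ae_isGoodPath] with ω hg
    simp only [mem_preimage, mem_prod, mem_Ici, inter_union_distrib_left,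
      union_empty_iff]
    rw [← hg.le_age_iff hs, ← hg.le_age_iff (hs.trans hst), div_le_iff₀' hl, div_le_iff₀' hl]
  rw [measure_congr e, hτ.poisson.measure_inter_eq_empty (measurableSet_Ioc.union measurableSet_Ioc)
    (measure_union_lt_top (by simp) (by simp)), volume_Ioc_union_Ioc hst]
  congr 3
  simp only [div_le_iff₀' hl]
  split_ifs with h
  · rw [mul_add, mul_max_of_nonneg _ _ hl.le, mul_max_of_nonneg _ _ hl.le, mul_zero,
      mul_div_cancel₀ _ hl.ne', mul_div_cancel₀ _ hl.ne']
  · rw [mul_max_of_nonneg _ _ hl.le, mul_add, mul_div_cancel₀ _ hl.ne',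
      mul_div_cancel₀ _ hl.ne']

/-- The law of the age of the Poisson process. -/
theorem IsPoissonPoints.map_age [IsProbabilityMeasure P] (hτ : IsPoissonPoints τ lam P)
    (hlam : 0 < lam) {s : ℝ} (hs : 0 ≤ s) :
    P.map (fun ω => lam * age τ s ω) = expMeasure 1 := by
  have h := congrArg (Measure.map Prod.fst) (hτ.map_age_age hlam hs le_rfl)
  rw [Measure.map_map measurable_fst (((measurable_age hτ.measurable s).const_mul _).prodMk
      ((measurable_age hτ.measurable s).const_mul _)),
    Measure.map_map measurable_fst (measurable_agePair _)] at h
  have e : Prod.fst ∘ agePair ((lam : ℝ) * (s - s)) = Prod.fst := rfl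
  rw [e, Measure.map_fst_prod, measure_univ, one_smul] at h
  exact h

end PoissonPoints

/-! ### Freezing an independent source of randomness. -/

section Independence

variable {Ω : Type*} [MeasurableSpace Ω] {P : Measure Ω} [IsProbabilityMeasure P]

lemma lintegral_comp_of_indepFun {α β : Type*} [MeasurableSpace α] [MeasurableSpace β]
    {X : Ω → α} {Y : Ω → β} (hX : Measurable X) (hY : Measurable Y) (h : IndepFun X Y P)
    {G : α → β → ℝ≥0∞} (hG : Measurable (Function.uncurry G)) :
    ∫⁻ ω, G (X ω) (Y ω) ∂P = ∫⁻ ω, ∫⁻ ω', G (X ω) (Y ω') ∂P ∂P := by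
  have h1 := (indepFun_iff_map_prod_eq_prod_map_map hX.aemeasurable hY.aemeasurable).1 h
  have h2 : ∫⁻ ω, G (X ω) (Y ω) ∂P
      = ∫⁻ p, Function.uncurry G p ∂(P.map fun ω => (X ω, Y ω)) := by
    rw [lintegral_map hG (hX.prodMk hY)]; rfl
  have := Measure.isProbabilityMeasure_map (μ := P) hY.aemeasurable
  rw [h2, h1, lintegral_prod _ hG.aemeasurable, lintegral_map hG.lintegral_prod_right' hX]
  refine lintegral_congr fun ω => ?_
  exact lintegral_map (f := fun y => G (X ω) y) (hG.comp measurable_prodMk_left) hY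

/-- The random indices are functions of `T` alone, so they can be frozen while the volatilities at
these indices are averaged. -/
lemma lintegral_mul_comp_index {α : Type*} [MeasurableSpace α] {T : Ω → α} (hT : Measurable T)
    {σ : ℕ → Ω → ℝ} (hσ : ∀ n, Measurable (σ n)) (h : IndepFun T (fun ω n => σ n ω) P)
    {f : α → ℝ≥0∞} (hf : Measurable f) {N M : α → ℕ} (hN : Measurable N) (hM : Measurable M)
    {K : ℝ → ℝ → ℝ≥0∞} (hK : Measurable (Function.uncurry K)) :
    ∫⁻ ω, f (T ω) * K (σ (N (T ω)) ω) (σ (M (T ω)) ω) ∂P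
      = ∫⁻ ω, f (T ω) * ∫⁻ ω', K (σ (N (T ω)) ω') (σ (M (T ω)) ω') ∂P ∂P := by
  have hev : Measurable fun p : ℕ × (ℕ → ℝ) => p.2 p.1 :=
    measurable_from_prod_countable_right fun n => measurable_pi_apply n
  have hG : Measurable (Function.uncurry fun (a : α) (s : ℕ → ℝ) =>
      f a * K (s (N a)) (s (M a))) :=
    (hf.comp measurable_fst).mul (hK.comp
      ((hev.comp ((hN.comp measurable_fst).prodMk measurable_snd)).prodMk
        (hev.comp ((hM.comp measurable_fst).prodMk measurable_snd))))
  rw [lintegral_comp_of_indepFun hT (measurable_pi_lambda _ hσ) h hG]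
  refine lintegral_congr fun ω => ?_
  rw [lintegral_const_mul]
  exact hK.comp ((hσ _).prodMk (hσ _))

end Independence

/-! ### Brownian motion at independent random times. -/

section Brownian

/-- The value at `r` of a path, recovered from its values at rational times. -/
noncomputable def regularValue (w : ℝ≥0 → ℝ) (r : ℝ≥0) : ℝ :=
  liminf (fun n : ℕ => w ((⌊(r : ℝ) * n⌋₊ : ℝ≥0) / n)) atTop

/-- Evaluation `(w, r) ↦ w r` is not jointly measurable for the product σ-algebra on all paths. This
substitute reads only countably many coordinates and agrees with evaluation on continuous paths. -/
lemma measurable_regularValue : Measurable (Function.uncurry regularValue) := by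
  refine Measurable.liminf fun n => ?_
  have hev : Measurable fun p : ℕ × (ℝ≥0 → ℝ) => p.2 ((p.1 : ℝ≥0) / n) :=
    measurable_from_prod_countable_right fun k => by
      exact measurable_pi_apply (X := fun _ : ℝ≥0 => ℝ) ((k : ℝ≥0) / n)
  refine hev.comp (Measurable.prodMk ?_ measurable_fst)
  exact Nat.measurable_floor.comp ((measurable_snd.coe_nnreal_real).mul_const _)

lemma regularValue_eq {w : ℝ≥0 → ℝ} (hw : Continuous w) (r : ℝ≥0) : regularValue w r = w r := by
  have h1 : Tendsto (fun n : ℕ => ((⌊(r : ℝ) * n⌋₊ : ℝ≥0) / n)) atTop (𝓝 r) := by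
    rw [← NNReal.tendsto_coe]
    push_cast
    exact (tendsto_nat_floor_mul_div_atTop r.2).comp tendsto_natCast_atTop_atTop
  exact ((hw.tendsto r).comp h1).liminf_eq

variable {Ω : Type*} [MeasurableSpace Ω] {P : Measure Ω} {W : ℝ≥0 → Ω → ℝ}

lemma aemeasurable_comp_of_continuous (hWm : ∀ r, Measurable (W r))
    (hc : ∀ᵐ ω ∂P, Continuous (W · ω)) {J : Ω → ℝ≥0} (hJ : Measurable J) :
    AEMeasurable (fun ω => W (J ω) ω) P := by
  refine ⟨fun ω => regularValue (fun r => W r ω) (J ω),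
    measurable_regularValue.comp ((measurable_pi_lambda _ hWm).prodMk hJ), ?_⟩
  filter_upwards [hc] with ω hω using (regularValue_eq hω _).symm

lemma lintegral_comp_randomTimes [IsProbabilityMeasure P] (hWm : ∀ r, Measurable (W r))
    (hc : ∀ᵐ ω ∂P, Continuous (W · ω)) {β : Type*} [MeasurableSpace β] {Z : Ω → β}
    (hZ : Measurable Z) (h : IndepFun (fun ω r => W r ω) Z P)
    {ι : Type*} {J : ι → β → ℝ≥0} (hJ : ∀ i, Measurable (J i))
    {K : (ι → ℝ) → ℝ≥0∞} (hK : Measurable K) :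
    ∫⁻ ω, K (fun i => W (J i (Z ω)) ω) ∂P
      = ∫⁻ ω, ∫⁻ ω', K (fun i => W (J i (Z ω)) ω') ∂P ∂P := by
  have hG : Measurable (Function.uncurry fun (z : β) (w : ℝ≥0 → ℝ) =>
      K (fun i => regularValue w (J i z))) :=
    hK.comp (measurable_pi_lambda _ fun i => measurable_regularValue.comp
      (measurable_snd.prodMk ((hJ i).comp measurable_fst)))
  have h2 := lintegral_comp_of_indepFun hZ (measurable_pi_lambda _ hWm) h.symm hG
  have h3 : ∫⁻ ω, K (fun i => W (J i (Z ω)) ω) ∂P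
      = ∫⁻ ω, K (fun i => regularValue (fun r => W r ω) (J i (Z ω))) ∂P := by
    refine lintegral_congr_ae ?_
    filter_upwards [hc] with ω hω
    simp only [regularValue_eq hω]
  rw [h3, h2]
  refine lintegral_congr fun ω => lintegral_congr_ae ?_
  filter_upwards [hc] with ω' hω'
  simp only [regularValue_eq hω']

lemma nndist_eq_tsub {r s : ℝ≥0} (h : r ≤ s) : nndist s.1 r.1 = s - r := by
  ext
  rw [coe_nndist, Real.dist_eq, NNReal.coe_sub h]
  exact abs_of_nonneg (sub_nonneg.2 (by exact_mod_cast h))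

lemma lintegral_sq_sub_brownian (hW : IsPreBrownianReal W P) {r s : ℝ≥0} (h : r ≤ s) :
    ∫⁻ ω, ENNReal.ofReal (|W s ω - W r ω| ^ 2) ∂P = ((s - r : ℝ≥0) : ℝ≥0∞) := by
  have h1 := (hW.hasLaw_sub s r).lintegral_comp (f := fun x => ENNReal.ofReal (x ^ 2))
    (by fun_prop)
  rw [lintegral_sq_gaussianReal, nndist_eq_tsub h] at h1
  simpa using h1

lemma lintegral_abs_sub_brownian (hW : IsPreBrownianReal W P) {r s : ℝ≥0} (h : r ≤ s) :
    ∫⁻ ω, ENNReal.ofReal |W s ω - W r ω| ∂P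
      = ENNReal.ofReal (√(2 / Real.pi)) * ENNReal.ofReal (√(s - r : ℝ≥0)) := by
  have h1 := (hW.hasLaw_sub s r).lintegral_comp (f := fun x => ENNReal.ofReal |x|)
    (by fun_prop)
  rw [lintegral_abs_gaussianReal, nndist_eq_tsub h] at h1
  simpa using h1

lemma lintegral_abs_mul_abs_brownian (hW : IsPreBrownianReal W P) (hWm : ∀ r, Measurable (W r))
    {r s r' s' : ℝ≥0} (h : r ≤ s) (h' : s ≤ r') (h'' : r' ≤ s') :
    ∫⁻ ω, ENNReal.ofReal |W s ω - W r ω| * ENNReal.ofReal |W s' ω - W r' ω| ∂P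
      = ENNReal.ofReal (2 / Real.pi)
        * (ENNReal.ofReal (√(s - r : ℝ≥0)) * ENNReal.ofReal (√(s' - r' : ℝ≥0))) := by
  have hind : IndepFun (W s - W r) (W s' - W r') P := by
    -- The four times as a monotone sequence; the two increments are those of index `0` and `2`.
    let t : ℕ → ℝ≥0
      | 0 => r
      | 1 => s
      | 2 => r'
      | _ => s'
    have ht : Monotone t := by
      refine monotone_nat_of_le_succ fun n => ?_
      match n with
      | 0 => exact h
      | 1 => exact h'
      | 2 => exact h''
      | n + 3 => exact le_rfl
    exact (hW.hasIndepIncrements.nat ht).indepFun (show (0 : ℕ) ≠ 2 by norm_num)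
  have hm : ∀ a b, Measurable fun ω => ENNReal.ofReal |W a ω - W b ω| := fun a b =>
    ENNReal.measurable_ofReal.comp ((hWm a).sub (hWm b)).abs
  have hφ : Measurable fun x : ℝ => ENNReal.ofReal |x| := by fun_prop
  have h1 := lintegral_mul_eq_lintegral_mul_lintegral_of_indepFun (hm s r) (hm s' r')
    (hind.comp hφ hφ)
  refine h1.trans ?_
  rw [lintegral_abs_sub_brownian hW h, lintegral_abs_sub_brownian hW h'',
    ← Real.mul_self_sqrt (show 0 ≤ 2 / Real.pi by positivity),
    ENNReal.ofReal_mul (Real.sqrt_nonneg _), Real.mul_self_sqrt (by positivity)]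
  ring

end Brownian

/-! ### Power moments of the exponential law. -/

section Moments

variable {D : ℝ} {ν : Measure ℝ}

lemma rpow_two_mul_sub_one {x : ℝ} (hx : 0 ≤ x) (D : ℝ) :
    x ^ (2 * D - 1) = x ^ (D - 1 / 2) * x ^ (D - 1 / 2) := by
  rw [← pow_two, ← Real.rpow_natCast, ← Real.rpow_mul hx]
  congr 1
  push_cast
  ring

/-- `E (S + x)^{D - 1/2}` for `S ∼ Exp(1)`. -/
noncomputable def powMean (D x : ℝ) : ℝ := ∫ s, (s + x) ^ (D - 1 / 2) ∂(expMeasure 1)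

/-- `E S^{D - 1/2} (S + x)^{D - 1/2}` for `S ∼ Exp(1)`. -/
noncomputable def powMeanMul (D x : ℝ) : ℝ :=
  ∫ s, s ^ (D - 1 / 2) * (s + x) ^ (D - 1 / 2) ∂(expMeasure 1)

/-- Since `D ≤ 1/2`, the square `(s + x)^(2D-1)` is at most `s^(2D-1)`, integrable by convergence of
the Gamma integral at `2D > 0`. -/
lemma memLp_add_rpow (hD₀ : 0 < D) (hD₁ : D ≤ 1 / 2) {x : ℝ} (hx : 0 ≤ x) :
    MemLp (fun s : ℝ => (s + x) ^ (D - 1 / 2)) 2 (expMeasure 1) := by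
  have hm : Measurable fun s : ℝ => (s + x) ^ (D - 1 / 2) :=
    (measurable_id.add_const x).pow_const _
  rw [memLp_two_iff_integrable_sq hm.aestronglyMeasurable]
  refine (integrable_rpow_expMeasure_one (a := 2 * D) (by linarith)).mono'
    (hm.pow_const 2).aestronglyMeasurable ?_
  filter_upwards [ae_pos_expMeasure_one] with s hs
  rw [Real.norm_of_nonneg (sq_nonneg _), pow_two, ← rpow_two_mul_sub_one (by linarith)]
  exact Real.rpow_le_rpow_of_nonpos hs (by linarith) (by linarith)

lemma memLp_rpow (hD₀ : 0 < D) (hD₁ : D ≤ 1 / 2) :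
    MemLp (fun s : ℝ => s ^ (D - 1 / 2)) 2 (expMeasure 1) := by
  simpa using memLp_add_rpow hD₀ hD₁ le_rfl

lemma lintegral_add_rpow (hD₀ : 0 < D) (hD₁ : D ≤ 1 / 2) {x : ℝ} (hx : 0 ≤ x) :
    ∫⁻ s, ENNReal.ofReal ((s + x) ^ (D - 1 / 2)) ∂(expMeasure 1)
      = ENNReal.ofReal (powMean D x) := by
  rw [powMean, ofReal_integral_eq_lintegral_ofReal
    ((memLp_add_rpow hD₀ hD₁ hx).integrable (by norm_num))]
  filter_upwards [ae_pos_expMeasure_one] with s hs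
  exact Real.rpow_nonneg (by linarith) _

lemma lintegral_rpow (hD₀ : 0 < D) (hD₁ : D ≤ 1 / 2) :
    ∫⁻ s, ENNReal.ofReal (s ^ (D - 1 / 2)) ∂(expMeasure 1) = ENNReal.ofReal (powMean D 0) := by
  simpa using lintegral_add_rpow hD₀ hD₁ le_rfl

lemma lintegral_rpow_mul_add_rpow (hD₀ : 0 < D) (hD₁ : D ≤ 1 / 2) {x : ℝ} (hx : 0 ≤ x) :
    ∫⁻ s, ENNReal.ofReal (s ^ (D - 1 / 2) * (s + x) ^ (D - 1 / 2)) ∂(expMeasure 1)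
      = ENNReal.ofReal (powMeanMul D x) := by
  have hi : Integrable (fun s : ℝ => s ^ (D - 1 / 2) * (s + x) ^ (D - 1 / 2)) (expMeasure 1) :=
    (memLp_rpow hD₀ hD₁).integrable_mul (memLp_add_rpow hD₀ hD₁ hx)
  rw [powMeanMul, ofReal_integral_eq_lintegral_ofReal hi]
  filter_upwards [ae_pos_expMeasure_one] with s hs
  exact mul_nonneg (Real.rpow_nonneg hs.le _) (Real.rpow_nonneg (by linarith) _)

lemma lintegral_rpow_two_mul_sub_one (hD₀ : 0 < D) (hD₁ : D ≤ 1 / 2) :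
    ∫⁻ s, ENNReal.ofReal (s ^ (2 * D - 1)) ∂(expMeasure 1)
      = ENNReal.ofReal (powMeanMul D 0) := by
  rw [← lintegral_rpow_mul_add_rpow hD₀ hD₁ le_rfl]
  refine lintegral_congr_ae ?_
  filter_upwards [ae_pos_expMeasure_one] with s hs
  rw [add_zero, rpow_two_mul_sub_one hs.le]

lemma powMean_nonneg {x : ℝ} (hx : 0 ≤ x) : 0 ≤ powMean D x := by
  refine integral_nonneg_of_ae ?_
  filter_upwards [ae_pos_expMeasure_one] with s hs
  exact Real.rpow_nonneg (by linarith) _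

lemma powMeanMul_nonneg {x : ℝ} (hx : 0 ≤ x) : 0 ≤ powMeanMul D x := by
  refine integral_nonneg_of_ae ?_
  filter_upwards [ae_pos_expMeasure_one] with s hs
  exact mul_nonneg (Real.rpow_nonneg hs.le _) (Real.rpow_nonneg (by linarith) _)

/-- By memorylessness the subtracted term is the part of `E S^(D-1/2)` carried by `S ≥ u`; the
difference is the part on `S < u`. -/
lemma powMean_sub_nonneg (hD₀ : 0 < D) (hD₁ : D ≤ 1 / 2) {u : ℝ} (hu : 0 ≤ u) :
    0 ≤ powMean D 0 - Real.exp (-u) * powMean D u := by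
  have h : ∫⁻ s in Ici u, ENNReal.ofReal (s ^ (D - 1 / 2)) ∂(expMeasure 1)
      ≤ ∫⁻ s, ENNReal.ofReal (s ^ (D - 1 / 2)) ∂(expMeasure 1) := setLIntegral_le_lintegral _ _
  have hm : Measurable fun s : ℝ => ENNReal.ofReal (s ^ (D - 1 / 2)) :=
    (measurable_id.pow_const _).ennreal_ofReal
  rw [setLIntegral_Ici_expMeasure_one hu hm, lintegral_rpow hD₀ hD₁, lintegral_add_rpow hD₀ hD₁ hu,
    ← ENNReal.ofReal_mul (Real.exp_nonneg _),
    ENNReal.ofReal_le_ofReal_iff (powMean_nonneg le_rfl)] at h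
  linarith

lemma setLIntegral_Iio_rpow (hD₀ : 0 < D) (hD₁ : D ≤ 1 / 2) {u : ℝ} (hu : 0 ≤ u) :
    ∫⁻ s in Iio u, ENNReal.ofReal (s ^ (D - 1 / 2)) ∂(expMeasure 1)
      = ENNReal.ofReal (powMean D 0 - Real.exp (-u) * powMean D u) := by
  have hm : Measurable fun s : ℝ => ENNReal.ofReal (s ^ (D - 1 / 2)) :=
    (measurable_id.pow_const _).ennreal_ofReal
  have h := lintegral_add_compl (μ := expMeasure 1)
    (fun s : ℝ => ENNReal.ofReal (s ^ (D - 1 / 2))) (measurableSet_Iio (a := u))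
  rw [compl_Iio, setLIntegral_Ici_expMeasure_one hu hm, lintegral_rpow hD₀ hD₁,
    lintegral_add_rpow hD₀ hD₁ hu, ← ENNReal.ofReal_mul (Real.exp_nonneg _)] at h
  rw [ENNReal.ofReal_sub _ (mul_nonneg (Real.exp_nonneg _) (powMean_nonneg hu)), ← h,
    ENNReal.add_sub_cancel_right ENNReal.ofReal_ne_top]

end Moments

/-- The hypotheses on the parameters and the random inputs of the model. -/
structure IsModel {Ω : Type*} [MeasurableSpace Ω] (P : Measure Ω) (D : ℝ) (lam : ℝ≥0)
    (ν : Measure ℝ) (W : ℝ≥0 → Ω → ℝ) (τ : ℤ → Ω → ℝ) (σ : ℕ → Ω → ℝ) : Prop where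
  D_pos : 0 < D
  D_le : D ≤ 1 / 2
  lam_pos : 0 < lam
  ae_pos : ∀ᵐ x ∂ν, 0 < x
  measurable_W : ∀ r, Measurable (W r)
  brownian : IsBrownianReal W P
  poisson : IsPoissonPoints τ lam P
  measurable_σ : ∀ n, Measurable (σ n)
  law_σ : ∀ n, HasLaw (σ n) ν P
  indep_σ : iIndepFun σ P
  indep_τσ : IndepFun (fun ω n => τ n ω) (fun ω n => σ n ω) P
  indep_W : IndepFun (fun ω r => W r ω) (fun ω => ((fun n => τ n ω), (fun n => σ n ω))) P
  integrable_sq : Integrable (fun x => x ^ 2) ν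

/-! ### Moments of the density of the clock. -/

namespace IsModel

variable {Ω : Type*} [MeasurableSpace Ω] {P : Measure Ω}
  {D : ℝ} {lam : ℝ≥0} {ν : Measure ℝ}
  {W : ℝ≥0 → Ω → ℝ} {τ : ℤ → Ω → ℝ} {σ : ℕ → Ω → ℝ}

lemma memLp_id (hM : IsModel P D lam ν W τ σ) : MemLp (fun x : ℝ => x) 2 ν :=
  (memLp_two_iff_integrable_sq measurable_id.aestronglyMeasurable).2 hM.integrable_sq

lemma lintegral_sq (hM : IsModel P D lam ν W τ σ) (n : ℕ) :
    ∫⁻ ω, ENNReal.ofReal (σ n ω ^ 2) ∂P = ENNReal.ofReal (∫ x, x ^ 2 ∂ν) := by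
  rw [(hM.law_σ n).lintegral_comp (f := fun x => ENNReal.ofReal (x ^ 2)) (by fun_prop),
    ofReal_integral_eq_lintegral_ofReal hM.integrable_sq (ae_of_all _ fun x => sq_nonneg x)]

lemma lintegral_abs [IsProbabilityMeasure ν] (hM : IsModel P D lam ν W τ σ) (n : ℕ) :
    ∫⁻ ω, ENNReal.ofReal |σ n ω| ∂P = ENNReal.ofReal (∫ x, x ∂ν) := by
  rw [(hM.law_σ n).lintegral_comp (f := fun x => ENNReal.ofReal |x|) (by fun_prop),
    ofReal_integral_eq_lintegral_ofReal (hM.memLp_id.integrable (by norm_num))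
      (hM.ae_pos.mono fun x hx => hx.le)]
  refine lintegral_congr_ae ?_
  filter_upwards [hM.ae_pos] with x hx
  rw [abs_of_pos hx]

lemma mean_nonneg (hM : IsModel P D lam ν W τ σ) : 0 ≤ ∫ x, x ∂ν :=
  integral_nonneg_of_ae (hM.ae_pos.mono fun _ hx => hx.le)

lemma lintegral_abs_mul_abs [IsProbabilityMeasure ν] (hM : IsModel P D lam ν W τ σ) (n m : ℕ) :
    ∫⁻ ω, ENNReal.ofReal |σ n ω| * ENNReal.ofReal |σ m ω| ∂P
      = ENNReal.ofReal (if n = m then ∫ x, x ^ 2 ∂ν else (∫ x, x ∂ν) ^ 2) := by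
  split_ifs with h
  · subst h
    rw [← hM.lintegral_sq n]
    refine lintegral_congr fun ω => ?_
    rw [← ENNReal.ofReal_mul (abs_nonneg _), abs_mul_abs_self, pow_two]
  · have hφ : Measurable fun x : ℝ => ENNReal.ofReal |x| := by fun_prop
    refine (lintegral_mul_eq_lintegral_mul_lintegral_of_indepFun
      (hφ.comp (hM.measurable_σ n)) (hφ.comp (hM.measurable_σ m))
      ((hM.indep_σ.indepFun h).comp hφ hφ)).trans ?_
    refine (congrArg₂ (· * ·) (hM.lintegral_abs n) (hM.lintegral_abs m)).trans ?_
    rw [← ENNReal.ofReal_mul hM.mean_nonneg, pow_two]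

/-- The scale factor of the density of the time change. -/
noncomputable def scale (D : ℝ) (lam : ℝ≥0) : ℝ := 2 * D * (lam : ℝ) ^ (1 - 2 * D)

lemma scale_pos (hM : IsModel P D lam ν W τ σ) : 0 < scale D lam := by
  have h1 : (0 : ℝ) < lam := by exact_mod_cast hM.lam_pos
  have := hM.D_pos
  unfold scale
  positivity

/-- Isolates the rescaled age, which is standard exponential, from the constants. -/
lemma rate_eq (hM : IsModel P D lam ν W τ σ) {ω : Ω} (hg : IsGoodPath τ ω) {t : ℝ} (ht : 0 ≤ t) :
    rate D τ σ t ω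
      = scale D lam * ((lam * age τ t ω) ^ (2 * D - 1) * σ (lastIndex τ t ω) ω ^ 2) := by
  have h1 : (0 : ℝ) < lam := by exact_mod_cast hM.lam_pos
  rw [rate, scale, Real.mul_rpow h1.le (hg.age_nonneg ht),
    show 1 - 2 * D = -(2 * D - 1) by ring, Real.rpow_neg h1.le]
  have := (Real.rpow_pos_of_pos h1 (2 * D - 1)).ne'
  field_simp

lemma sqrt_rate_eq (hM : IsModel P D lam ν W τ σ) {ω : Ω} (hg : IsGoodPath τ ω) {t : ℝ}
    (ht : 0 ≤ t) : √(rate D τ σ t ω)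
      = √(scale D lam) * ((lam * age τ t ω) ^ (D - 1 / 2) * |σ (lastIndex τ t ω) ω|) := by
  have h : 0 ≤ lam * age τ t ω := mul_nonneg lam.2 (hg.age_nonneg ht)
  rw [hM.rate_eq hg ht, Real.sqrt_mul hM.scale_pos.le, rpow_two_mul_sub_one h,
    Real.sqrt_mul (mul_self_nonneg _), Real.sqrt_mul_self (Real.rpow_nonneg h _),
    Real.sqrt_sq_eq_abs]

lemma measurable_points (hM : IsModel P D lam ν W τ σ) :
    Measurable fun ω (n : ℤ) => τ n ω := measurable_pi_lambda _ hM.poisson.measurable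

/-- The value does not depend on `t`. This stationarity replaces a uniform domination in the passage
to the limit. -/
lemma lintegral_rate [IsProbabilityMeasure P] (hM : IsModel P D lam ν W τ σ) {t : ℝ} (ht : 0 ≤ t) :
    ∫⁻ ω, ENNReal.ofReal (rate D τ σ t ω) ∂P
      = ENNReal.ofReal (scale D lam * ((∫ x, x ^ 2 ∂ν) * powMeanMul D 0)) := by
  have hev : ∀ n : ℤ, Measurable fun z : ℤ → ℝ => z n := fun n => measurable_pi_apply n
  have hφ : Measurable fun x : ℝ => ENNReal.ofReal (x ^ (2 * D - 1)) :=
    (measurable_id.pow_const _).ennreal_ofReal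
  have hma : Measurable fun ω => (lam : ℝ) * age τ t ω :=
    (measurable_age hM.poisson.measurable t).const_mul _
  -- Age and index are read as functionals on the sequence space `ℤ → ℝ`, through its coordinate
  -- process.
  have h1 := lintegral_mul_comp_index hM.measurable_points hM.measurable_σ hM.indep_τσ
    (f := fun z => ENNReal.ofReal ((lam * age (fun n z => z n) t z) ^ (2 * D - 1)))
    (hφ.comp ((measurable_age hev t).const_mul _))
    (measurable_lastIndex hev t) (measurable_lastIndex hev t)
    (K := fun x _ => ENNReal.ofReal (x ^ 2)) (by
      exact (measurable_fst.pow_const 2).ennreal_ofReal)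
  have h2 : ∫⁻ ω, ENNReal.ofReal (rate D τ σ t ω) ∂P = ∫⁻ ω, ENNReal.ofReal (scale D lam) *
      (ENNReal.ofReal ((lam * age τ t ω) ^ (2 * D - 1)) *
        ENNReal.ofReal (σ (lastIndex τ t ω) ω ^ 2)) ∂P := by
    refine lintegral_congr_ae ?_
    filter_upwards [hM.poisson.ae_isGoodPath] with ω hg
    have h : 0 ≤ lam * age τ t ω := mul_nonneg lam.2 (hg.age_nonneg ht)
    rw [hM.rate_eq hg ht, ENNReal.ofReal_mul hM.scale_pos.le,
      ENNReal.ofReal_mul (Real.rpow_nonneg h _)]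
  rw [h2, lintegral_const_mul' _ _ ENNReal.ofReal_ne_top, ENNReal.ofReal_mul hM.scale_pos.le]
  congr 1
  refine h1.trans ?_
  simp only [hM.lintegral_sq]
  rw [lintegral_mul_const' _ _ ENNReal.ofReal_ne_top, mul_comm, ENNReal.ofReal_mul
    (integral_nonneg fun x => sq_nonneg x)]
  congr 1
  rw [← lintegral_rpow_two_mul_sub_one hM.D_pos hM.D_le, ← hM.poisson.map_age hM.lam_pos ht,
    lintegral_map hφ hma]
  rfl

lemma lintegral_sqrt_rate [IsProbabilityMeasure P] [IsProbabilityMeasure ν]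
    (hM : IsModel P D lam ν W τ σ) {t : ℝ} (ht : 0 ≤ t) :
    ∫⁻ ω, ENNReal.ofReal (√(rate D τ σ t ω)) ∂P
      = ENNReal.ofReal (√(scale D lam) * ((∫ x, x ∂ν) * powMean D 0)) := by
  have hev : ∀ n : ℤ, Measurable fun z : ℤ → ℝ => z n := fun n => measurable_pi_apply n
  have hφ : Measurable fun x : ℝ => ENNReal.ofReal (x ^ (D - 1 / 2)) :=
    (measurable_id.pow_const _).ennreal_ofReal
  have hma : Measurable fun ω => (lam : ℝ) * age τ t ω :=
    (measurable_age hM.poisson.measurable t).const_mul _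
  have h1 := lintegral_mul_comp_index hM.measurable_points hM.measurable_σ hM.indep_τσ
    (f := fun z => ENNReal.ofReal ((lam * age (fun n z => z n) t z) ^ (D - 1 / 2)))
    (hφ.comp ((measurable_age hev t).const_mul _))
    (measurable_lastIndex hev t) (measurable_lastIndex hev t)
    (K := fun x _ => ENNReal.ofReal |x|) (by
      exact measurable_fst.abs.ennreal_ofReal)
  have h2 : ∫⁻ ω, ENNReal.ofReal (√(rate D τ σ t ω)) ∂P = ∫⁻ ω, ENNReal.ofReal (√(scale D lam)) *
      (ENNReal.ofReal ((lam * age τ t ω) ^ (D - 1 / 2)) *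
        ENNReal.ofReal |σ (lastIndex τ t ω) ω|) ∂P := by
    refine lintegral_congr_ae ?_
    filter_upwards [hM.poisson.ae_isGoodPath] with ω hg
    have h : 0 ≤ lam * age τ t ω := mul_nonneg lam.2 (hg.age_nonneg ht)
    rw [hM.sqrt_rate_eq hg ht, ENNReal.ofReal_mul (Real.sqrt_nonneg _),
      ENNReal.ofReal_mul (Real.rpow_nonneg h _)]
  rw [h2, lintegral_const_mul' _ _ ENNReal.ofReal_ne_top, ENNReal.ofReal_mul (Real.sqrt_nonneg _)]
  congr 1
  refine h1.trans ?_
  simp only [hM.lintegral_abs]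
  rw [lintegral_mul_const' _ _ ENNReal.ofReal_ne_top, mul_comm, ENNReal.ofReal_mul hM.mean_nonneg]
  congr 1
  rw [← lintegral_rpow hM.D_pos hM.D_le, ← hM.poisson.map_age hM.lam_pos ht,
    lintegral_map hφ hma]
  rfl

lemma lintegral_agePair (hM : IsModel P D lam ν W τ σ) {u m₁ m₂ : ℝ} (hu : 0 ≤ u) (hm₁ : 0 ≤ m₁)
    (hm₂ : 0 ≤ m₂) :
    ∫⁻ p, ENNReal.ofReal (p.1 ^ (D - 1 / 2)) * ENNReal.ofReal (p.2 ^ (D - 1 / 2))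
        * ENNReal.ofReal (if u ≤ p.2 then m₂ else m₁)
        ∂(((expMeasure 1).prod (expMeasure 1)).map (agePair u))
      = ENNReal.ofReal (m₂ * (Real.exp (-u) * powMeanMul D u)
        + m₁ * (powMean D 0 * (powMean D 0 - Real.exp (-u) * powMean D u))) := by
  have hφ : Measurable fun x : ℝ => ENNReal.ofReal (x ^ (D - 1 / 2)) :=
    (measurable_id.pow_const _).ennreal_ofReal
  have hG : Measurable fun p : ℝ × ℝ => ENNReal.ofReal (p.1 ^ (D - 1 / 2))
      * ENNReal.ofReal (p.2 ^ (D - 1 / 2)) * ENNReal.ofReal (if u ≤ p.2 then m₂ else m₁) :=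
    ((hφ.comp measurable_fst).mul (hφ.comp measurable_snd)).mul
      (Measurable.ite (measurableSet_le measurable_const measurable_snd)
        measurable_const measurable_const).ennreal_ofReal
  have hL0 := powMean_sub_nonneg hM.D_pos hM.D_le hu
  rw [lintegral_map hG (measurable_agePair u),
    lintegral_prod _ (by exact (hG.comp (measurable_agePair u)).aemeasurable)]
  have hinner : ∀ᵐ x ∂(expMeasure 1), ∫⁻ y, ENNReal.ofReal ((agePair u (x, y)).1 ^ (D - 1 / 2))
      * ENNReal.ofReal ((agePair u (x, y)).2 ^ (D - 1 / 2))
      * ENNReal.ofReal (if u ≤ (agePair u (x, y)).2 then m₂ else m₁) ∂(expMeasure 1)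
      = ENNReal.ofReal (m₂ * Real.exp (-u))
          * ENNReal.ofReal (x ^ (D - 1 / 2) * (x + u) ^ (D - 1 / 2))
        + ENNReal.ofReal (m₁ * (powMean D 0 - Real.exp (-u) * powMean D u))
          * ENNReal.ofReal (x ^ (D - 1 / 2)) := by
    filter_upwards [ae_pos_expMeasure_one] with x hx
    -- On `y ≥ u` no point separates the two times and the ages differ by `u`; on `y < u` the
    -- integrand factorizes.
    rw [← lintegral_add_compl _ (measurableSet_Ici (a := u)), compl_Ici]
    have hxr : 0 ≤ x ^ (D - 1 / 2) := Real.rpow_nonneg hx.le _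
    congr 1
    · rw [setLIntegral_congr_fun (g := fun _ => ENNReal.ofReal m₂
        * ENNReal.ofReal (x ^ (D - 1 / 2) * (x + u) ^ (D - 1 / 2))) measurableSet_Ici]
      · rw [setLIntegral_const, expMeasure_one_Ici, max_eq_left hu, ENNReal.ofReal_mul hm₂]
        ring
      · intro y hy
        have hy' : ¬ y < u := not_lt.2 hy
        simp only [agePair, if_neg hy', if_pos (show u ≤ x + u by linarith)]
        rw [ENNReal.ofReal_mul hxr, mul_comm]
    · rw [setLIntegral_congr_fun (g := fun y => (ENNReal.ofReal m₁
        * ENNReal.ofReal (x ^ (D - 1 / 2))) * ENNReal.ofReal (y ^ (D - 1 / 2))) measurableSet_Iio]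
      · rw [lintegral_const_mul _ hφ, setLIntegral_Iio_rpow hM.D_pos hM.D_le hu,
          ENNReal.ofReal_mul hm₁]
        ring
      · intro y hy
        simp only [agePair, if_pos (show y < u from hy), if_neg (not_le.2 (show y < u from hy))]
        ring
  rw [lintegral_congr_ae hinner, lintegral_add_left' (by
    refine (Measurable.const_mul ?_ _).aemeasurable
    exact ((measurable_id.pow_const _).mul
      ((measurable_id.add_const u).pow_const _)).ennreal_ofReal),
    lintegral_const_mul' _ _ ENNReal.ofReal_ne_top, lintegral_const_mul' _ _ ENNReal.ofReal_ne_top,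
    lintegral_rpow_mul_add_rpow hM.D_pos hM.D_le hu, lintegral_rpow hM.D_pos hM.D_le,
    ← ENNReal.ofReal_mul (by positivity), ← ENNReal.ofReal_mul (by positivity),
    ← ENNReal.ofReal_add]
  · congr 1; ring
  · have := powMeanMul_nonneg (D := D) hu
    positivity
  · have := powMean_nonneg (D := D) le_rfl
    positivity

/-- Given the points, the volatilities contribute `E σ²` when the two last indices agree and `(E
σ)²` otherwise. Agreement is an event of the later age, so the joint law of the ages suffices. -/
lemma lintegral_sqrt_rate_mul [IsProbabilityMeasure P] [IsProbabilityMeasure ν]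
    (hM : IsModel P D lam ν W τ σ) {s t : ℝ} (hs : 0 ≤ s)
    (hst : s ≤ t) :
    ∫⁻ ω, ENNReal.ofReal (√(rate D τ σ s ω) * √(rate D τ σ t ω)) ∂P
      = ENNReal.ofReal (scale D lam *
        ((∫ x, x ^ 2 ∂ν) * (Real.exp (-(lam * (t - s))) * powMeanMul D (lam * (t - s)))
        + (∫ x, x ∂ν) ^ 2 * (powMean D 0 *
          (powMean D 0 - Real.exp (-(lam * (t - s))) * powMean D (lam * (t - s)))))) := by
  have hl : (0 : ℝ) < lam := by exact_mod_cast hM.lam_pos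
  have hev : ∀ n : ℤ, Measurable fun z : ℤ → ℝ => z n := fun n => measurable_pi_apply n
  have hφ : Measurable fun x : ℝ => ENNReal.ofReal (x ^ (D - 1 / 2)) :=
    (measurable_id.pow_const _).ennreal_ofReal
  have hma : Measurable fun ω => ((lam : ℝ) * age τ s ω, (lam : ℝ) * age τ t ω) :=
    ((measurable_age hM.poisson.measurable s).const_mul _).prodMk
      ((measurable_age hM.poisson.measurable t).const_mul _)
  have h1 := lintegral_mul_comp_index hM.measurable_points hM.measurable_σ hM.indep_τσ
    (f := fun z => ENNReal.ofReal ((lam * age (fun n z => z n) s z) ^ (D - 1 / 2))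
      * ENNReal.ofReal ((lam * age (fun n z => z n) t z) ^ (D - 1 / 2)))
    ((hφ.comp ((measurable_age hev s).const_mul _)).mul
      (hφ.comp ((measurable_age hev t).const_mul _)))
    (measurable_lastIndex hev s) (measurable_lastIndex hev t)
    (K := fun x y => ENNReal.ofReal |x| * ENNReal.ofReal |y|) (by
      exact measurable_fst.abs.ennreal_ofReal.mul measurable_snd.abs.ennreal_ofReal)
  have h2 : ∫⁻ ω, ENNReal.ofReal (√(rate D τ σ s ω) * √(rate D τ σ t ω)) ∂P
      = ∫⁻ ω, ENNReal.ofReal (scale D lam) *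
      (ENNReal.ofReal ((lam * age τ s ω) ^ (D - 1 / 2)) *
        ENNReal.ofReal ((lam * age τ t ω) ^ (D - 1 / 2)) *
        (ENNReal.ofReal |σ (lastIndex τ s ω) ω| * ENNReal.ofReal |σ (lastIndex τ t ω) ω|)) ∂P := by
    refine lintegral_congr_ae ?_
    filter_upwards [hM.poisson.ae_isGoodPath] with ω hg
    have h : 0 ≤ lam * age τ s ω := mul_nonneg lam.2 (hg.age_nonneg hs)
    have h' : 0 ≤ lam * age τ t ω := mul_nonneg lam.2 (hg.age_nonneg (hs.trans hst))
    rw [hM.sqrt_rate_eq hg hs, hM.sqrt_rate_eq hg (hs.trans hst),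
      ← ENNReal.ofReal_mul (Real.rpow_nonneg h _), ← ENNReal.ofReal_mul (abs_nonneg _),
      ← ENNReal.ofReal_mul (mul_nonneg (Real.rpow_nonneg h _) (Real.rpow_nonneg h' _)),
      ← ENNReal.ofReal_mul hM.scale_pos.le]
    nth_rw 3 [← Real.mul_self_sqrt hM.scale_pos.le]
    congr 1; ring
  rw [h2, lintegral_const_mul' _ _ ENNReal.ofReal_ne_top, ENNReal.ofReal_mul hM.scale_pos.le]
  congr 1
  refine h1.trans ?_
  simp only [hM.lintegral_abs_mul_abs]
  rw [← hM.lintegral_agePair (mul_nonneg hl.le (sub_nonneg.2 hst)) (sq_nonneg _)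
    (integral_nonneg fun x => sq_nonneg x), ← hM.poisson.map_age_age hM.lam_pos hs hst,
    lintegral_map _ hma]
  · refine lintegral_congr_ae ?_
    filter_upwards [hM.poisson.ae_isGoodPath] with ω hg
    have h3 : lastIndex τ s ω = lastIndex τ t ω ↔ (lam : ℝ) * (t - s) ≤ lam * age τ t ω := by
      rw [hg.lastIndex_eq_iff hs hst, mul_le_mul_iff_right₀ hl]
    simp only [← h3]
    rfl
  · exact ((hφ.comp measurable_fst).mul (hφ.comp measurable_snd)).mul
      (Measurable.ite (measurableSet_le measurable_const measurable_snd)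
        measurable_const measurable_const).ennreal_ofReal

end IsModel

/-! ### Covariance and variance in the limit. -/

section LimitLaw

variable {D : ℝ} {ν : Measure ℝ}

lemma measurable_shiftedVol (D x : ℝ) : Measurable (shiftedVol D x) :=
  measurable_fst.mul ((measurable_snd.add_const x).pow_const _)

lemma memLp_shiftedVol (hD₀ : 0 < D) (hD₁ : D ≤ 1 / 2) (hν : MemLp (fun x : ℝ => x) 2 ν) {x : ℝ}
    (hx : 0 ≤ x) : MemLp (shiftedVol D x) 2 (lawσS ν) := by
  rw [memLp_two_iff_integrable_sq (measurable_shiftedVol D x).aestronglyMeasurable]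
  have h := Integrable.mul_prod hν.integrable_sq (memLp_add_rpow hD₀ hD₁ hx).integrable_sq
  refine h.congr (ae_of_all _ fun p => ?_)
  simp only [shiftedVol]
  ring

lemma phi_eq [IsProbabilityMeasure ν] (hD₀ : 0 < D) (hD₁ : D ≤ 1 / 2)
    (hν : MemLp (fun x : ℝ => x) 2 ν) {x : ℝ}
    (hx : 0 ≤ x) : phi D ν x = (∫ y, y ^ 2 ∂ν) * powMeanMul D x
      - (∫ y, y ∂ν) ^ 2 * (powMean D 0 * powMean D x) := by
  have hprob : IsProbabilityMeasure (lawσS ν) := by unfold lawσS; infer_instance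
  have h1 : ∀ z, ∫ p, shiftedVol D z p ∂(lawσS ν) = (∫ y, y ∂ν) * powMean D z := fun z =>
    integral_prod_mul (μ := ν) (ν := expMeasure 1) (fun y : ℝ => y)
      (fun s : ℝ => (s + z) ^ (D - 1 / 2))
  have h2 : ∫ p, (shiftedVol D 0 * shiftedVol D x) p ∂(lawσS ν)
      = (∫ y, y ^ 2 ∂ν) * powMeanMul D x := by
    refine Eq.trans ?_ (integral_prod_mul (μ := ν) (ν := expMeasure 1) (fun y : ℝ => y ^ 2)
      (fun s : ℝ => s ^ (D - 1 / 2) * (s + x) ^ (D - 1 / 2)))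
    refine integral_congr_ae (ae_of_all _ fun p => ?_)
    simp only [Pi.mul_apply, shiftedVol, add_zero]
    ring
  rw [phi, covariance_eq_sub (memLp_shiftedVol hD₀ hD₁ hν le_rfl) (memLp_shiftedVol hD₀ hD₁ hν hx),
    h1, h1, h2]
  ring

lemma measurable_limitAbs (D : ℝ) : Measurable (limitAbs D) :=
  (measurable_fst.mul (measurable_snd.comp measurable_snd).abs).mul
    ((measurable_fst.comp measurable_snd).pow_const _)

lemma integral_sq_gaussianReal_one : ∫ x, x ^ 2 ∂(gaussianReal 0 1) = 1 := by
  rw [integral_eq_lintegral_of_nonneg_ae (ae_of_all _ fun x => sq_nonneg x)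
    (by fun_prop), lintegral_sq_gaussianReal]
  simp

lemma integral_abs_gaussianReal_one : ∫ x, |x| ∂(gaussianReal 0 1) = √(2 / Real.pi) := by
  rw [integral_eq_lintegral_of_nonneg_ae (ae_of_all _ fun x => abs_nonneg x)
    (by fun_prop), lintegral_abs_gaussianReal_one,
    ENNReal.toReal_ofReal (Real.sqrt_nonneg _)]

lemma integrable_sq_rpow (hD₀ : 0 < D) (hD₁ : D ≤ 1 / 2) :
    Integrable (fun s : ℝ => s ^ (D - 1 / 2) * s ^ (D - 1 / 2)) (expMeasure 1) :=
  (memLp_rpow hD₀ hD₁).integrable_mul (memLp_rpow hD₀ hD₁)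

lemma limitAbs_sq (D : ℝ) (p : ℝ × ℝ × ℝ) : limitAbs D p ^ 2
    = p.1 ^ 2 * ((p.2.1 ^ (D - 1 / 2) * p.2.1 ^ (D - 1 / 2)) * p.2.2 ^ 2) := by
  rw [limitAbs, ← sq_abs p.2.2]; ring

lemma memLp_limitAbs (hD₀ : 0 < D) (hD₁ : D ≤ 1 / 2) (hν : MemLp (fun x : ℝ => x) 2 ν) :
    MemLp (limitAbs D) 2 (lawσSW ν) := by
  rw [memLp_two_iff_integrable_sq (measurable_limitAbs D).aestronglyMeasurable]
  simp only [limitAbs_sq]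
  exact Integrable.mul_prod (f := fun x : ℝ => x ^ 2)
    (g := fun p : ℝ × ℝ => (p.1 ^ (D - 1 / 2) * p.1 ^ (D - 1 / 2)) * p.2 ^ 2) hν.integrable_sq
    (Integrable.mul_prod (f := fun s : ℝ => s ^ (D - 1 / 2) * s ^ (D - 1 / 2))
      (g := fun x : ℝ => x ^ 2) (integrable_sq_rpow hD₀ hD₁)
      (memLp_id_gaussianReal 2).integrable_sq)

lemma variance_limitAbs [IsProbabilityMeasure ν] (hD₀ : 0 < D) (hD₁ : D ≤ 1 / 2)
    (hν : MemLp (fun x : ℝ => x) 2 ν) :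
    Var[limitAbs D; lawσSW ν] = (∫ y, y ^ 2 ∂ν) * powMeanMul D 0
      - 2 / Real.pi * ((∫ y, y ∂ν) * powMean D 0) ^ 2 := by
  have hprob : IsProbabilityMeasure (lawσSW ν) := by unfold lawσSW; infer_instance
  have h2 : ∫ p, (limitAbs D ^ 2) p ∂(lawσSW ν) = (∫ y, y ^ 2 ∂ν) * powMeanMul D 0 := by
    simp only [Pi.pow_apply, limitAbs_sq]
    refine (integral_prod_mul (μ := ν) (ν := (expMeasure 1).prod (gaussianReal 0 1))
      (fun x : ℝ => x ^ 2)
      (fun p : ℝ × ℝ => (p.1 ^ (D - 1 / 2) * p.1 ^ (D - 1 / 2)) * p.2 ^ 2)).trans ?_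
    rw [integral_prod_mul (fun s : ℝ => s ^ (D - 1 / 2) * s ^ (D - 1 / 2)) (fun x : ℝ => x ^ 2),
      integral_sq_gaussianReal_one, mul_one, powMeanMul]
    simp only [add_zero]
  have h1 : ∫ p, limitAbs D p ∂(lawσSW ν) = (∫ y, y ∂ν) * (powMean D 0 * √(2 / Real.pi)) := by
    have e : ∀ p : ℝ × ℝ × ℝ, limitAbs D p = p.1 * (p.2.1 ^ (D - 1 / 2) * |p.2.2|) := fun p => by
      rw [limitAbs]; ring
    simp only [e]
    refine (integral_prod_mul (μ := ν) (ν := (expMeasure 1).prod (gaussianReal 0 1))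
      (fun x : ℝ => x) (fun p : ℝ × ℝ => p.1 ^ (D - 1 / 2) * |p.2|)).trans ?_
    rw [integral_prod_mul (fun s : ℝ => s ^ (D - 1 / 2)) (fun x : ℝ => |x|),
      integral_abs_gaussianReal_one, powMean]
    simp only [add_zero]
  rw [variance_eq_sub (memLp_limitAbs hD₀ hD₁ hν), h2, h1]
  have := Real.sq_sqrt (show 0 ≤ 2 / Real.pi by positivity)
  linear_combination (-(∫ y, y ∂ν) ^ 2 * powMean D 0 ^ 2) * this

lemma integral_pos_of_ae_pos {α : Type*} [MeasurableSpace α] {μ : Measure α}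
    [IsProbabilityMeasure μ] {f : α → ℝ} (hf : ∀ᵐ x ∂μ, 0 < f x) (hi : Integrable f μ) :
    0 < ∫ x, f x ∂μ := by
  have hf' : 0 ≤ᵐ[μ] f := hf.mono fun _ h => h.le
  refine lt_of_le_of_ne (integral_nonneg_of_ae hf') fun h => ?_
  obtain ⟨x, h1, h2⟩ := (((integral_eq_zero_iff_of_nonneg_ae hf' hi).1 h.symm).and hf).exists
  exact h2.ne' h1

lemma powMeanMul_zero_pos (hD₀ : 0 < D) (hD₁ : D ≤ 1 / 2) : 0 < powMeanMul D 0 := by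
  have hi : Integrable (fun s : ℝ => s ^ (D - 1 / 2) * (s + 0) ^ (D - 1 / 2)) (expMeasure 1) := by
    simpa using integrable_sq_rpow hD₀ hD₁
  have hpos : ∀ᵐ s ∂(expMeasure 1), 0 < s ^ (D - 1 / 2) * (s + 0) ^ (D - 1 / 2) := by
    filter_upwards [ae_pos_expMeasure_one] with s hs
    have := Real.rpow_pos_of_pos hs (D - 1 / 2)
    rw [add_zero]; positivity
  exact integral_pos_of_ae_pos hpos hi

lemma integral_sq_pos [IsProbabilityMeasure ν] (hν0 : ∀ᵐ x ∂ν, 0 < x) (hν : MemLp (fun x : ℝ => x) 2 ν) :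
    0 < ∫ x, x ^ 2 ∂ν :=
  integral_pos_of_ae_pos (hν0.mono fun _ h => pow_pos h 2) hν.integrable_sq

lemma sq_integral_le {α : Type*} [MeasurableSpace α] {μ : Measure α} [IsProbabilityMeasure μ]
    {f : α → ℝ} (hf : MemLp f 2 μ) : (∫ x, f x ∂μ) ^ 2 ≤ ∫ x, f x ^ 2 ∂μ := by
  have h := variance_nonneg f μ
  rw [variance_eq_sub hf] at h
  simpa using h

lemma two_div_pi_lt_one : 2 / Real.pi < 1 := by
  rw [div_lt_one Real.pi_pos]
  linarith [Real.pi_gt_three]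

/-- Jensen for `σ` and for `S^(D-1/2)` bounds the squared mean; the factor `2/π < 1` from `|W₁|`
makes the gap strict, even for constant `σ` and `D = 1/2`. -/
lemma variance_limitAbs_pos [IsProbabilityMeasure ν] (hD₀ : 0 < D) (hD₁ : D ≤ 1 / 2)
    (hν0 : ∀ᵐ x ∂ν, 0 < x)
    (hν : MemLp (fun x : ℝ => x) 2 ν) : 0 < Var[limitAbs D; lawσSW ν] := by
  rw [variance_limitAbs hD₀ hD₁ hν]
  have h1 := sq_integral_le hν
  have h2 := sq_integral_le (memLp_rpow hD₀ hD₁)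
  have h3 : powMean D 0 ^ 2 ≤ powMeanMul D 0 := by
    simpa [powMean, powMeanMul, ← pow_two] using h2
  have h4 := mul_pos (integral_sq_pos hν0 hν) (powMeanMul_zero_pos hD₀ hD₁)
  have h5 : ((∫ y, y ∂ν) * powMean D 0) ^ 2 ≤ (∫ y, y ^ 2 ∂ν) * powMeanMul D 0 := by
    rw [mul_pow]
    exact mul_le_mul h1 h3 (sq_nonneg _) (integral_nonneg fun x => sq_nonneg x)
  have h6 := mul_le_mul_of_nonneg_left h5 (show 0 ≤ 2 / Real.pi by positivity)
  have h7 := mul_lt_mul_of_pos_right two_div_pi_lt_one h4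
  linarith

end LimitLaw

/-- The increment of the time change over `[t, t + h]`. -/
noncomputable def clockIncr {Ω : Type*} (D : ℝ) (τ : ℤ → Ω → ℝ) (σ : ℕ → Ω → ℝ) (h t : ℝ)
    (ω : Ω) : ℝ := clock D τ σ (t + h) ω - clock D τ σ t ω

/-- The mean of the density of the time change. -/
noncomputable def meanRate (D : ℝ) (lam : ℝ≥0) (ν : Measure ℝ) : ℝ :=
  IsModel.scale D lam * ((∫ x, x ^ 2 ∂ν) * powMeanMul D 0)

/-! ### Increments of the clock. -/

namespace IsModel

variable {Ω : Type*} [MeasurableSpace Ω] {P : Measure Ω}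
  {D : ℝ} {lam : ℝ≥0} {ν : Measure ℝ}
  {W : ℝ≥0 → Ω → ℝ} {τ : ℤ → Ω → ℝ} {σ : ℕ → Ω → ℝ}

lemma meanRate_pos [IsProbabilityMeasure ν] (hM : IsModel P D lam ν W τ σ) :
    0 < meanRate D lam ν :=
  mul_pos hM.scale_pos (mul_pos (integral_sq_pos hM.ae_pos hM.memLp_id)
    (powMeanMul_zero_pos hM.D_pos hM.D_le))

lemma measurable_clockIncr (hM : IsModel P D lam ν W τ σ) (h t : ℝ) :
    Measurable (clockIncr D τ σ h t) :=
  (measurable_clock hM.poisson.measurable hM.measurable_σ _).sub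
    (measurable_clock hM.poisson.measurable hM.measurable_σ _)

lemma ae_clockIncr_nonneg (hM : IsModel P D lam ν W τ σ) {h t : ℝ} (hh : 0 ≤ h) (ht : 0 ≤ t) :
    ∀ᵐ ω ∂P, 0 ≤ clockIncr D τ σ h t ω := by
  filter_upwards [hM.poisson.ae_isGoodPath] with ω hg
  exact sub_nonneg.2 (hg.clock_mono hM.D_pos ht (by linarith))

variable [IsProbabilityMeasure P]

/-- Tonelli, with the mean density constant in time: the mean increment is exactly linear in `h`,
not just asymptotically. -/
lemma lintegral_clockIncr (hM : IsModel P D lam ν W τ σ) {h t : ℝ} (hh : 0 ≤ h) (ht : 0 ≤ t) :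
    ∫⁻ ω, ENNReal.ofReal (clockIncr D τ σ h t ω) ∂P = ENNReal.ofReal (h * meanRate D lam ν) := by
  have h1 : ∫⁻ ω, ENNReal.ofReal (clockIncr D τ σ h t ω) ∂P
      = ∫⁻ ω, (∫⁻ u in Ioc t (t + h), ENNReal.ofReal (rate D τ σ u ω)) ∂P := by
    refine lintegral_congr_ae ?_
    filter_upwards [hM.poisson.ae_isGoodPath] with ω hg
    exact (hg.lintegral_rate hM.D_pos ht (by linarith)).symm
  have hm : Measurable fun p : Ω × ℝ => ENNReal.ofReal (rate D τ σ p.2 p.1) :=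
    ((measurable_rate_uncurry hM.poisson.measurable hM.measurable_σ).comp
      measurable_swap).ennreal_ofReal
  rw [h1, lintegral_lintegral_swap hm.aemeasurable,
    setLIntegral_congr_fun (g := fun _ => ENNReal.ofReal (meanRate D lam ν)) measurableSet_Ioc
      (fun u hu => hM.lintegral_rate (ht.trans hu.1.le)), setLIntegral_const, Real.volume_Ioc,
    add_sub_cancel_left, mul_comm, ENNReal.ofReal_mul hh]

lemma integrable_clockIncr (hM : IsModel P D lam ν W τ σ) {h t : ℝ} (hh : 0 ≤ h) (ht : 0 ≤ t) :
    Integrable (clockIncr D τ σ h t) P := by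
  refine ⟨(hM.measurable_clockIncr h t).aestronglyMeasurable, ?_⟩
  rw [hasFiniteIntegral_iff_ofReal (hM.ae_clockIncr_nonneg hh ht), hM.lintegral_clockIncr hh ht]
  exact ENNReal.ofReal_lt_top

lemma memLp_sqrt_clockIncr (hM : IsModel P D lam ν W τ σ) {h t : ℝ} (hh : 0 ≤ h) (ht : 0 ≤ t) :
    MemLp (fun ω => √(clockIncr D τ σ h t ω)) 2 P := by
  have hm : Measurable fun ω => √(clockIncr D τ σ h t ω) := (hM.measurable_clockIncr h t).sqrt
  rw [memLp_two_iff_integrable_sq hm.aestronglyMeasurable]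
  refine (hM.integrable_clockIncr hh ht).congr ?_
  filter_upwards [hM.ae_clockIncr_nonneg hh ht] with ω hω
  rw [Real.sq_sqrt hω]

variable [IsProbabilityMeasure ν]

lemma integral_clockIncr (hM : IsModel P D lam ν W τ σ) {h t : ℝ} (hh : 0 ≤ h) (ht : 0 ≤ t) :
    ∫ ω, clockIncr D τ σ h t ω ∂P = h * meanRate D lam ν := by
  rw [integral_eq_lintegral_of_nonneg_ae (hM.ae_clockIncr_nonneg hh ht)
    (hM.measurable_clockIncr h t).aestronglyMeasurable, hM.lintegral_clockIncr hh ht,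
    ENNReal.toReal_ofReal (mul_nonneg hh hM.meanRate_pos.le)]

end IsModel

/-- The time change as a function of the points and the volatilities. -/
noncomputable def clockFun (D t : ℝ) (z : (ℤ → ℝ) × (ℕ → ℝ)) : ℝ≥0 :=
  (clock D (fun n (z : (ℤ → ℝ) × (ℕ → ℝ)) => z.1 n) (fun n z => z.2 n) t z).toNNReal

lemma measurable_clockFun (D t : ℝ) : Measurable (clockFun D t) :=
  (measurable_clock (fun n => (measurable_pi_apply n).comp measurable_fst)
    (fun n => (measurable_pi_apply n).comp measurable_snd) t).real_toNNReal

lemma absIncr_nonneg {Ω : Type*} {D : ℝ} {W : ℝ≥0 → Ω → ℝ} {τ : ℤ → Ω → ℝ} {σ : ℕ → Ω → ℝ}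
    (h t : ℝ) (ω : Ω) : 0 ≤ absIncr D W τ σ h t ω := abs_nonneg _

/-! ### Moments of the price increments and the limit. -/

namespace IsModel

variable {Ω : Type*} [MeasurableSpace Ω] {P : Measure Ω}
  {D : ℝ} {lam : ℝ≥0} {ν : Measure ℝ} {W : ℝ≥0 → Ω → ℝ} {τ : ℤ → Ω → ℝ} {σ : ℕ → Ω → ℝ}

lemma measurable_sources (hM : IsModel P D lam ν W τ σ) :
    Measurable fun ω => ((fun n => τ n ω), (fun n => σ n ω)) :=
  hM.measurable_points.prodMk (measurable_pi_lambda _ hM.measurable_σ)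

lemma aemeasurable_absIncr (hM : IsModel P D lam ν W τ σ) (h t : ℝ) :
    AEMeasurable (absIncr D W τ σ h t) P := by
  have hp : ∀ t, AEMeasurable (price D W τ σ t) P := fun t =>
    aemeasurable_comp_of_continuous hM.measurable_W hM.brownian.cont
      (measurable_clock hM.poisson.measurable hM.measurable_σ t).real_toNNReal
  exact ((hp _).sub (hp _)).abs

lemma clock_toNNReal_sub (hM : IsModel P D lam ν W τ σ) {ω : Ω} (hg : IsGoodPath τ ω) {h t : ℝ}
    (hh : 0 ≤ h) (ht : 0 ≤ t) :
    (((clock D τ σ (t + h) ω).toNNReal - (clock D τ σ t ω).toNNReal : ℝ≥0) : ℝ)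
      = clockIncr D τ σ h t ω := by
  have h1 := hg.clock_nonneg hM.D_pos (σ := σ) ht
  have h2 := hg.clock_mono hM.D_pos (σ := σ) ht (show t ≤ t + h by linarith)
  rw [NNReal.coe_sub (Real.toNNReal_le_toNNReal h2), Real.coe_toNNReal _ h1,
    Real.coe_toNNReal _ (h1.trans h2), clockIncr]

variable [IsProbabilityMeasure P]

lemma lintegral_sq_absIncr (hM : IsModel P D lam ν W τ σ) {h t : ℝ} (hh : 0 ≤ h) (ht : 0 ≤ t) :
    ∫⁻ ω, ENNReal.ofReal (absIncr D W τ σ h t ω ^ 2) ∂P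
      = ∫⁻ ω, ENNReal.ofReal (clockIncr D τ σ h t ω) ∂P := by
  have h1 := lintegral_comp_randomTimes hM.measurable_W hM.brownian.cont hM.measurable_sources
    hM.indep_W (J := ![clockFun D t, clockFun D (t + h)])
    (fun i => by fin_cases i <;> exact measurable_clockFun _ _)
    (K := fun x => ENNReal.ofReal (|x 1 - x 0| ^ 2)) (by fun_prop)
  refine h1.trans (lintegral_congr_ae ?_)
  filter_upwards [hM.poisson.ae_isGoodPath] with ω hg
  have h2 := hg.clock_mono hM.D_pos (σ := σ) ht (show t ≤ t + h by linarith)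
  refine (lintegral_sq_sub_brownian hM.brownian.toIsPreBrownianReal
    (Real.toNNReal_le_toNNReal h2)).trans ?_
  rw [← hM.clock_toNNReal_sub hg hh ht, ENNReal.ofReal_coe_nnreal]

lemma lintegral_absIncr (hM : IsModel P D lam ν W τ σ) {h t : ℝ} (hh : 0 ≤ h) (ht : 0 ≤ t) :
    ∫⁻ ω, ENNReal.ofReal (absIncr D W τ σ h t ω) ∂P
      = ENNReal.ofReal (√(2 / Real.pi))
        * ∫⁻ ω, ENNReal.ofReal (√(clockIncr D τ σ h t ω)) ∂P := by
  have h1 := lintegral_comp_randomTimes hM.measurable_W hM.brownian.cont hM.measurable_sources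
    hM.indep_W (J := ![clockFun D t, clockFun D (t + h)])
    (fun i => by fin_cases i <;> exact measurable_clockFun _ _)
    (K := fun x => ENNReal.ofReal |x 1 - x 0|) (by fun_prop)
  rw [← lintegral_const_mul' _ _ ENNReal.ofReal_ne_top]
  refine h1.trans (lintegral_congr_ae ?_)
  filter_upwards [hM.poisson.ae_isGoodPath] with ω hg
  have h2 := hg.clock_mono hM.D_pos (σ := σ) ht (show t ≤ t + h by linarith)
  refine (lintegral_abs_sub_brownian hM.brownian.toIsPreBrownianReal
    (Real.toNNReal_le_toNNReal h2)).trans ?_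
  rw [hM.clock_toNNReal_sub hg hh ht]

/-- As the clock is monotone, `s + h ≤ t` keeps the two Brownian time intervals from overlapping, so
the increments are independent once the clock is frozen. -/
lemma lintegral_absIncr_mul (hM : IsModel P D lam ν W τ σ) {h s t : ℝ} (hh : 0 ≤ h) (hs : 0 ≤ s)
    (hst : s + h ≤ t) :
    ∫⁻ ω, ENNReal.ofReal (absIncr D W τ σ h s ω * absIncr D W τ σ h t ω) ∂P
      = ENNReal.ofReal (2 / Real.pi) * ∫⁻ ω, ENNReal.ofReal
        (√(clockIncr D τ σ h s ω) * √(clockIncr D τ σ h t ω)) ∂P := by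
  have h1 := lintegral_comp_randomTimes hM.measurable_W hM.brownian.cont hM.measurable_sources
    hM.indep_W (J := ![clockFun D s, clockFun D (s + h), clockFun D t, clockFun D (t + h)])
    (fun i => by fin_cases i <;> exact measurable_clockFun _ _)
    (K := fun x => ENNReal.ofReal |x 1 - x 0| * ENNReal.ofReal |x 3 - x 2|) (by fun_prop)
  rw [← lintegral_const_mul' _ _ ENNReal.ofReal_ne_top]
  simp only [ENNReal.ofReal_mul (abs_nonneg _), ENNReal.ofReal_mul (Real.sqrt_nonneg _), absIncr]
  refine h1.trans (lintegral_congr_ae ?_)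
  filter_upwards [hM.poisson.ae_isGoodPath] with ω hg
  have h2 := hg.clock_mono hM.D_pos (σ := σ) hs (show s ≤ s + h by linarith)
  have h3 := hg.clock_mono hM.D_pos (σ := σ) (by linarith) hst
  have h4 := hg.clock_mono hM.D_pos (σ := σ) (show 0 ≤ t by linarith) (show t ≤ t + h by linarith)
  refine (lintegral_abs_mul_abs_brownian hM.brownian.toIsPreBrownianReal hM.measurable_W
    (Real.toNNReal_le_toNNReal h2) (Real.toNNReal_le_toNNReal h3)
    (Real.toNNReal_le_toNNReal h4)).trans ?_
  rw [hM.clock_toNNReal_sub hg hh hs, hM.clock_toNNReal_sub hg hh (by linarith)]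

lemma memLp_absIncr (hM : IsModel P D lam ν W τ σ) {h t : ℝ} (hh : 0 ≤ h) (ht : 0 ≤ t) :
    MemLp (absIncr D W τ σ h t) 2 P := by
  have hm := hM.aemeasurable_absIncr h t
  rw [memLp_two_iff_integrable_sq hm.aestronglyMeasurable]
  refine ⟨(hm.pow_const 2).aestronglyMeasurable, ?_⟩
  rw [hasFiniteIntegral_iff_ofReal (ae_of_all _ fun ω => sq_nonneg _),
    hM.lintegral_sq_absIncr hh ht, hM.lintegral_clockIncr hh ht]
  exact ENNReal.ofReal_lt_top

lemma integral_absIncr (hM : IsModel P D lam ν W τ σ) {h t : ℝ} (hh : 0 ≤ h) (ht : 0 ≤ t) :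
    ∫ ω, absIncr D W τ σ h t ω ∂P
      = √(2 / Real.pi) * ∫ ω, √(clockIncr D τ σ h t ω) ∂P := by
  rw [integral_eq_lintegral_of_nonneg_ae (ae_of_all _ fun ω => absIncr_nonneg h t ω)
    (hM.aemeasurable_absIncr h t).aestronglyMeasurable, hM.lintegral_absIncr hh ht,
    integral_eq_lintegral_of_nonneg_ae (ae_of_all _ fun ω => Real.sqrt_nonneg _)
    (hM.measurable_clockIncr h t).sqrt.aestronglyMeasurable, ENNReal.toReal_mul,
    ENNReal.toReal_ofReal (Real.sqrt_nonneg _)]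

lemma integral_absIncr_mul (hM : IsModel P D lam ν W τ σ) {h s t : ℝ} (hh : 0 ≤ h) (hs : 0 ≤ s)
    (hst : s + h ≤ t) :
    ∫ ω, absIncr D W τ σ h s ω * absIncr D W τ σ h t ω ∂P
      = 2 / Real.pi * ∫ ω, √(clockIncr D τ σ h s ω) * √(clockIncr D τ σ h t ω) ∂P := by
  rw [integral_eq_lintegral_of_nonneg_ae
      (ae_of_all _ fun ω => mul_nonneg (absIncr_nonneg h s ω) (absIncr_nonneg h t ω))
      ((hM.aemeasurable_absIncr h s).mul (hM.aemeasurable_absIncr h t)).aestronglyMeasurable,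
    hM.lintegral_absIncr_mul hh hs hst,
    integral_eq_lintegral_of_nonneg_ae
      (ae_of_all _ fun ω => mul_nonneg (Real.sqrt_nonneg _) (Real.sqrt_nonneg _))
      ((hM.measurable_clockIncr h s).sqrt.mul
        (hM.measurable_clockIncr h t).sqrt).aestronglyMeasurable,
    ENNReal.toReal_mul, ENNReal.toReal_ofReal (by positivity)]

lemma covariance_absIncr (hM : IsModel P D lam ν W τ σ) {h s t : ℝ} (hh : 0 ≤ h) (hs : 0 ≤ s)
    (hst : s + h ≤ t) :
    cov[absIncr D W τ σ h s, absIncr D W τ σ h t; P] = 2 / Real.pi *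
      (∫ ω, √(clockIncr D τ σ h s ω) * √(clockIncr D τ σ h t ω) ∂P
        - (∫ ω, √(clockIncr D τ σ h s ω) ∂P) * ∫ ω, √(clockIncr D τ σ h t ω) ∂P) := by
  have ht : 0 ≤ t := by linarith
  have h1 : ∫ ω, (absIncr D W τ σ h s * absIncr D W τ σ h t) ω ∂P = _ :=
    hM.integral_absIncr_mul hh hs hst
  rw [covariance_eq_sub (hM.memLp_absIncr hh hs) (hM.memLp_absIncr hh ht), h1,
    hM.integral_absIncr hh hs, hM.integral_absIncr hh ht]
  have := Real.mul_self_sqrt (show 0 ≤ 2 / Real.pi by positivity)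
  linear_combination (-(∫ ω, √(clockIncr D τ σ h s ω) ∂P) *
    ∫ ω, √(clockIncr D τ σ h t ω) ∂P) * this

lemma integral_rate [IsProbabilityMeasure ν] (hM : IsModel P D lam ν W τ σ) {t : ℝ} (ht : 0 ≤ t) :
    Integrable (rate D τ σ t) P ∧ ∫ ω, rate D τ σ t ω ∂P = meanRate D lam ν := by
  have hm := (measurable_rate (D := D) hM.poisson.measurable hM.measurable_σ t).aestronglyMeasurable
    (μ := P)
  have h0 : 0 ≤ᵐ[P] rate D τ σ t := by
    filter_upwards [hM.poisson.ae_isGoodPath] with ω hg using hg.rate_nonneg hM.D_pos ht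
  constructor
  · refine ⟨hm, ?_⟩
    rw [hasFiniteIntegral_iff_ofReal h0, hM.lintegral_rate ht]
    exact ENNReal.ofReal_lt_top
  · rw [integral_eq_lintegral_of_nonneg_ae h0 hm, hM.lintegral_rate ht, ENNReal.toReal_ofReal]
    · rfl
    · exact hM.meanRate_pos.le

variable [IsProbabilityMeasure ν]

lemma integral_sqrt_rate (hM : IsModel P D lam ν W τ σ) {t : ℝ} (ht : 0 ≤ t) :
    ∫ ω, √(rate D τ σ t ω) ∂P = √(scale D lam) * ((∫ x, x ∂ν) * powMean D 0) := by
  rw [integral_eq_lintegral_of_nonneg_ae (ae_of_all _ fun ω => Real.sqrt_nonneg _)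
    (measurable_rate hM.poisson.measurable hM.measurable_σ t).sqrt.aestronglyMeasurable,
    hM.lintegral_sqrt_rate ht, ENNReal.toReal_ofReal]
  have := hM.mean_nonneg
  have := powMean_nonneg (D := D) le_rfl
  positivity

lemma integral_sqrt_rate_mul (hM : IsModel P D lam ν W τ σ) {s t : ℝ} (hs : 0 ≤ s)
    (hst : s ≤ t) :
    ∫ ω, √(rate D τ σ s ω) * √(rate D τ σ t ω) ∂P = scale D lam *
        ((∫ x, x ^ 2 ∂ν) * (Real.exp (-(lam * (t - s))) * powMeanMul D (lam * (t - s)))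
        + (∫ x, x ∂ν) ^ 2 * (powMean D 0 *
          (powMean D 0 - Real.exp (-(lam * (t - s))) * powMean D (lam * (t - s))))) := by
  have hu : 0 ≤ (lam : ℝ) * (t - s) := mul_nonneg lam.2 (sub_nonneg.2 hst)
  rw [integral_eq_lintegral_of_nonneg_ae
      (ae_of_all _ fun ω => mul_nonneg (Real.sqrt_nonneg _) (Real.sqrt_nonneg _))
      ((measurable_rate hM.poisson.measurable hM.measurable_σ s).sqrt.mul
        (measurable_rate hM.poisson.measurable hM.measurable_σ t).sqrt).aestronglyMeasurable,
    hM.lintegral_sqrt_rate_mul hs hst, ENNReal.toReal_ofReal]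
  have h1 := powMean_nonneg (D := D) le_rfl
  have h2 := powMeanMul_nonneg (D := D) hu
  have h3 := powMean_sub_nonneg hM.D_pos hM.D_le hu
  have h4 := hM.scale_pos.le
  have h5 : 0 ≤ ∫ x, x ^ 2 ∂ν := integral_nonneg fun x => sq_nonneg x
  positivity

/-- The bound `√x ≤ 1 + x` dominates by functions whose integrals are the same for all `h > 0`. -/
lemma tendsto_integral_sqrt (hM : IsModel P D lam ν W τ σ) {t : ℝ} (ht : 0 ≤ t) :
    Tendsto (fun h => ∫ ω, √(clockIncr D τ σ h t ω / h) ∂P) (𝓝[>] 0)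
      (𝓝 (∫ ω, √(rate D τ σ t ω) ∂P)) := by
  have hconv : ∀ᵐ ω ∂P, Tendsto (fun h => clockIncr D τ σ h t ω / h) (𝓝[>] 0)
      (𝓝 (rate D τ σ t ω)) := by
    filter_upwards [hM.poisson.ae_isGoodPath, hM.poisson.ae_ne t] with ω hg hne
    exact hg.tendsto_clock ht hne
  have hb : ∀ x : ℝ, 0 ≤ x → √x ≤ 1 + x := fun x hx => by
    nlinarith [Real.sq_sqrt hx, sq_nonneg (√x - 1), Real.sqrt_nonneg x]
  refine tendsto_integral_of_dominated_of_integral_eq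
    (m := fun h ω => 1 + clockIncr D τ σ h t ω / h) (m₀ := fun ω => 1 + rate D τ σ t ω)
    ?_ ?_ ?_ ?_ ?_ ?_ ?_ ?_ ?_ ?_
  · exact Eventually.of_forall fun h =>
      ((hM.measurable_clockIncr h t).div_const h).sqrt.aestronglyMeasurable
  · exact Eventually.of_forall fun h => ae_of_all _ fun ω => Real.sqrt_nonneg _
  · filter_upwards [self_mem_nhdsWithin] with h hh
    filter_upwards [hM.ae_clockIncr_nonneg (le_of_lt hh) ht] with ω hω
    exact hb _ (div_nonneg hω (le_of_lt hh))
  · filter_upwards [self_mem_nhdsWithin] with h hh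
    exact (integrable_const 1).add ((hM.integrable_clockIncr (le_of_lt hh) ht).div_const h)
  · exact (integrable_const 1).add (hM.integral_rate ht).1
  · filter_upwards [hconv] with ω hω using hω.sqrt
  · filter_upwards [hconv] with ω hω using hω.const_add 1
  · refine tendsto_const_nhds.congr' ?_
    filter_upwards [self_mem_nhdsWithin] with h hh
    have hh' : h ≠ 0 := ne_of_gt hh
    rw [integral_add (integrable_const 1) (hM.integral_rate ht).1,
      integral_add (integrable_const 1) ((hM.integrable_clockIncr (le_of_lt hh) ht).div_const h),
      integral_div, hM.integral_clockIncr (le_of_lt hh) ht, (hM.integral_rate ht).2,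
      mul_div_cancel_left₀ _ hh']
  · filter_upwards [hM.poisson.ae_isGoodPath] with ω hg
    exact add_nonneg zero_le_one (hg.rate_nonneg hM.D_pos ht)
  · filter_upwards [hM.poisson.ae_isGoodPath] with ω hg
    exact hb _ (hg.rate_nonneg hM.D_pos ht)

/-- Same argument, with the bound `√x √y ≤ x + y`. -/
lemma tendsto_integral_sqrt_mul (hM : IsModel P D lam ν W τ σ) {s t : ℝ} (hs : 0 ≤ s)
    (ht : 0 ≤ t) :
    Tendsto (fun h => ∫ ω, √(clockIncr D τ σ h s ω / h) * √(clockIncr D τ σ h t ω / h) ∂P)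
      (𝓝[>] 0) (𝓝 (∫ ω, √(rate D τ σ s ω) * √(rate D τ σ t ω) ∂P)) := by
  have hconv : ∀ {t : ℝ}, 0 ≤ t → ∀ᵐ ω ∂P, Tendsto (fun h => clockIncr D τ σ h t ω / h) (𝓝[>] 0)
      (𝓝 (rate D τ σ t ω)) := by
    intro t ht
    filter_upwards [hM.poisson.ae_isGoodPath, hM.poisson.ae_ne t] with ω hg hne
    exact hg.tendsto_clock ht hne
  have hb : ∀ x y : ℝ, 0 ≤ x → 0 ≤ y → √x * √y ≤ x + y := fun x y hx hy => by
    nlinarith [Real.sq_sqrt hx, Real.sq_sqrt hy, sq_nonneg (√x - √y), Real.sqrt_nonneg x,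
      Real.sqrt_nonneg y, mul_nonneg (Real.sqrt_nonneg x) (Real.sqrt_nonneg y)]
  refine tendsto_integral_of_dominated_of_integral_eq
    (m := fun h ω => clockIncr D τ σ h s ω / h + clockIncr D τ σ h t ω / h)
    (m₀ := fun ω => rate D τ σ s ω + rate D τ σ t ω)
    ?_ ?_ ?_ ?_ ?_ ?_ ?_ ?_ ?_ ?_
  · exact Eventually.of_forall fun h => (((hM.measurable_clockIncr h s).div_const h).sqrt.mul
      ((hM.measurable_clockIncr h t).div_const h).sqrt).aestronglyMeasurable
  · exact Eventually.of_forall fun h => ae_of_all _ fun ω =>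
      mul_nonneg (Real.sqrt_nonneg _) (Real.sqrt_nonneg _)
  · filter_upwards [self_mem_nhdsWithin] with h hh
    filter_upwards [hM.ae_clockIncr_nonneg (le_of_lt hh) hs,
      hM.ae_clockIncr_nonneg (le_of_lt hh) ht] with ω hω hω'
    exact hb _ _ (div_nonneg hω (le_of_lt hh)) (div_nonneg hω' (le_of_lt hh))
  · filter_upwards [self_mem_nhdsWithin] with h hh
    exact ((hM.integrable_clockIncr (le_of_lt hh) hs).div_const h).add
      ((hM.integrable_clockIncr (le_of_lt hh) ht).div_const h)
  · exact (hM.integral_rate hs).1.add (hM.integral_rate ht).1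
  · filter_upwards [hconv hs, hconv ht] with ω hω hω' using hω.sqrt.mul hω'.sqrt
  · filter_upwards [hconv hs, hconv ht] with ω hω hω' using hω.add hω'
  · refine tendsto_const_nhds.congr' ?_
    filter_upwards [self_mem_nhdsWithin] with h hh
    have hh' : h ≠ 0 := ne_of_gt hh
    rw [integral_add (hM.integral_rate hs).1 (hM.integral_rate ht).1,
      integral_add ((hM.integrable_clockIncr (le_of_lt hh) hs).div_const h)
        ((hM.integrable_clockIncr (le_of_lt hh) ht).div_const h),
      integral_div, integral_div, hM.integral_clockIncr (le_of_lt hh) hs,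
      hM.integral_clockIncr (le_of_lt hh) ht, (hM.integral_rate hs).2, (hM.integral_rate ht).2,
      mul_div_cancel_left₀ _ hh']
  · filter_upwards [hM.poisson.ae_isGoodPath] with ω hg
    exact add_nonneg (hg.rate_nonneg hM.D_pos hs) (hg.rate_nonneg hM.D_pos ht)
  · filter_upwards [hM.poisson.ae_isGoodPath] with ω hg
    exact hb _ _ (hg.rate_nonneg hM.D_pos hs) (hg.rate_nonneg hM.D_pos ht)

lemma variance_absIncr (hM : IsModel P D lam ν W τ σ) {h t : ℝ} (hh : 0 ≤ h) (ht : 0 ≤ t) :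
    Var[absIncr D W τ σ h t; P] = h * meanRate D lam ν
      - 2 / Real.pi * (∫ ω, √(clockIncr D τ σ h t ω) ∂P) ^ 2 := by
  have h1 : ∫ ω, (absIncr D W τ σ h t ^ 2) ω ∂P = h * meanRate D lam ν := by
    simp only [Pi.pow_apply]
    rw [integral_eq_lintegral_of_nonneg_ae (ae_of_all _ fun ω => sq_nonneg _)
      ((hM.aemeasurable_absIncr h t).pow_const 2).aestronglyMeasurable,
      hM.lintegral_sq_absIncr hh ht, hM.lintegral_clockIncr hh ht,
      ENNReal.toReal_ofReal (mul_nonneg hh hM.meanRate_pos.le)]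
  rw [variance_eq_sub (hM.memLp_absIncr hh ht), h1, hM.integral_absIncr hh ht, mul_pow,
    Real.sq_sqrt (by positivity)]

/-- Jensen for `√ΔI` together with `2/π < 1`, at every fixed `h > 0`. -/
lemma variance_absIncr_pos (hM : IsModel P D lam ν W τ σ) {h t : ℝ} (hh : 0 < h) (ht : 0 ≤ t) :
    0 < Var[absIncr D W τ σ h t; P] := by
  rw [hM.variance_absIncr hh.le ht]
  have h1 := sq_integral_le (hM.memLp_sqrt_clockIncr hh.le ht)
  have h2 : ∫ ω, √(clockIncr D τ σ h t ω) ^ 2 ∂P = h * meanRate D lam ν := by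
    rw [← hM.integral_clockIncr hh.le ht]
    refine integral_congr_ae ?_
    filter_upwards [hM.ae_clockIncr_nonneg hh.le ht] with ω hω
    exact Real.sq_sqrt hω
  rw [h2] at h1
  have h3 := mul_le_mul_of_nonneg_left h1 (show 0 ≤ 2 / Real.pi by positivity)
  have h4 := mul_lt_mul_of_pos_right two_div_pi_lt_one (mul_pos hh hM.meanRate_pos)
  linarith

/-- The correlation coefficient in terms of the normalized increments of the time change. -/
lemma corr_absIncr (hM : IsModel P D lam ν W τ σ) {h s t : ℝ} (hh : 0 < h) (hs : 0 ≤ s)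
    (hst : s + h ≤ t) :
    corr (absIncr D W τ σ h s) (absIncr D W τ σ h t) P = 2 / Real.pi *
      (∫ ω, √(clockIncr D τ σ h s ω / h) * √(clockIncr D τ σ h t ω / h) ∂P
        - (∫ ω, √(clockIncr D τ σ h s ω / h) ∂P) * ∫ ω, √(clockIncr D τ σ h t ω / h) ∂P)
      / √((meanRate D lam ν - 2 / Real.pi * (∫ ω, √(clockIncr D τ σ h s ω / h) ∂P) ^ 2)
        * (meanRate D lam ν - 2 / Real.pi * (∫ ω, √(clockIncr D τ σ h t ω / h) ∂P) ^ 2)) := by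
  have ht : 0 ≤ t := by linarith
  have hsq : √h * √h = h := Real.mul_self_sqrt hh.le
  have hsp : 0 < √h := Real.sqrt_pos.2 hh
  have e1 : ∀ t, ∫ ω, √(clockIncr D τ σ h t ω) ∂P
      = √h * ∫ ω, √(clockIncr D τ σ h t ω / h) ∂P := fun t => by
    rw [← integral_const_mul]
    refine integral_congr_ae (ae_of_all _ fun ω => ?_)
    simp only [Real.sqrt_div' _ hh.le]
    field_simp
  have e2 : ∫ ω, √(clockIncr D τ σ h s ω) * √(clockIncr D τ σ h t ω) ∂P
      = h * ∫ ω, √(clockIncr D τ σ h s ω / h) * √(clockIncr D τ σ h t ω / h) ∂P := by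
    rw [← integral_const_mul]
    refine integral_congr_ae (ae_of_all _ fun ω => ?_)
    simp only [Real.sqrt_div' _ hh.le]
    nth_rw 3 [← hsq]
    field_simp
  rw [corr, hM.covariance_absIncr hh.le hs hst, hM.variance_absIncr hh.le hs,
    hM.variance_absIncr hh.le ht, e1 s, e1 t, e2]
  generalize ∫ ω, √(clockIncr D τ σ h s ω / h) * √(clockIncr D τ σ h t ω / h) ∂P = r
  generalize ∫ ω, √(clockIncr D τ σ h s ω / h) ∂P = a
  generalize ∫ ω, √(clockIncr D τ σ h t ω / h) ∂P = b
  have e3 : ∀ a : ℝ, h * meanRate D lam ν - 2 / Real.pi * (√h * a) ^ 2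
      = h * (meanRate D lam ν - 2 / Real.pi * a ^ 2) := fun a => by
    rw [mul_pow, Real.sq_sqrt hh.le]; ring
  -- Numerator and denominator each scale by exactly `h`, which cancels.
  rw [e3, e3, show ∀ x y : ℝ, h * x * (h * y) = (h * h) * (x * y) by intros; ring,
    Real.sqrt_mul (mul_self_nonneg h), Real.sqrt_mul_self hh.le,
    show 2 / Real.pi * (h * r - √h * a * (√h * b)) = h * (2 / Real.pi * (r - a * b)) by
      linear_combination (-(2 / Real.pi) * a * b) * hsq,
    mul_div_mul_left _ _ hh.ne']

lemma tendsto_corr_of_lt (hM : IsModel P D lam ν W τ σ) {s t : ℝ} (hs : 0 ≤ s) (hst : s < t) :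
    Tendsto (fun h => corr (absIncr D W τ σ h s) (absIncr D W τ σ h t) P) (𝓝[>] 0)
      (𝓝 (rho D lam ν (t - s))) := by
  have ht : 0 ≤ t := hs.trans hst.le
  have hu : 0 ≤ (lam : ℝ) * (t - s) := mul_nonneg lam.2 (sub_nonneg.2 hst.le)
  have hsc := hM.scale_pos
  have hV := variance_limitAbs_pos hM.D_pos hM.D_le hM.ae_pos hM.memLp_id
  have hVe := variance_limitAbs hM.D_pos hM.D_le hM.memLp_id
  have hphi := phi_eq hM.D_pos hM.D_le hM.memLp_id hu
  have hs' := hM.tendsto_integral_sqrt hs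
  have ht' := hM.tendsto_integral_sqrt ht
  have hst' := hM.tendsto_integral_sqrt_mul hs ht
  have hden : meanRate D lam ν - 2 / Real.pi *
      (√(scale D lam) * ((∫ x, x ∂ν) * powMean D 0)) ^ 2
      = scale D lam * Var[limitAbs D; lawσSW ν] := by
    rw [hVe, mul_pow, Real.sq_sqrt hsc.le, meanRate]; ring
  -- The `powMean D 0 ^ 2` term of the separated case cancels the product of the means; what remains
  -- carries the factor `e^{-u}` and is `phi_eq`.
  have hnum : 2 / Real.pi * (scale D lam *
        ((∫ x, x ^ 2 ∂ν) * (Real.exp (-(lam * (t - s))) * powMeanMul D (lam * (t - s)))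
        + (∫ x, x ∂ν) ^ 2 * (powMean D 0 *
          (powMean D 0 - Real.exp (-(lam * (t - s))) * powMean D (lam * (t - s)))))
      - √(scale D lam) * ((∫ x, x ∂ν) * powMean D 0)
        * (√(scale D lam) * ((∫ x, x ∂ν) * powMean D 0)))
      = scale D lam * (2 / Real.pi * (Real.exp (-(lam * (t - s))) * phi D ν (lam * (t - s)))) := by
    have := Real.mul_self_sqrt hsc.le
    rw [hphi]
    linear_combination (-(2 / Real.pi) * ((∫ x, x ∂ν) * powMean D 0) ^ 2) * this
  rw [hM.integral_sqrt_rate hs] at hs'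
  rw [hM.integral_sqrt_rate ht] at ht'
  rw [hM.integral_sqrt_rate_mul hs hst.le] at hst'
  have hlim := ((hst'.sub (hs'.mul ht')).const_mul (2 / Real.pi)).div
    ((((hs'.pow 2).const_mul (2 / Real.pi)).const_sub (meanRate D lam ν)).mul
      (((ht'.pow 2).const_mul (2 / Real.pi)).const_sub (meanRate D lam ν))).sqrt (by
        rw [hden, Real.sqrt_mul_self (by positivity)]; positivity)
  rw [hden, hnum, Real.sqrt_mul_self (by positivity), mul_div_mul_left _ _ hsc.ne'] at hlim
  have hrho : rho D lam ν (t - s) = 2 / Real.pi * (Real.exp (-(lam * (t - s)))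
      * phi D ν (lam * (t - s))) / Var[limitAbs D; lawσSW ν] := by
    rw [rho, abs_of_pos (sub_pos.2 hst), neg_mul]
    have := Real.pi_pos
    field_simp
  rw [hrho]
  refine hlim.congr' ?_
  -- The product formula needs disjoint intervals, which holds once `h < t - s`.
  have hev : ∀ᶠ h in 𝓝[>] (0 : ℝ), h < t - s :=
    nhdsWithin_le_nhds (Iio_mem_nhds (sub_pos.2 hst))
  filter_upwards [hev, self_mem_nhdsWithin] with h hh hh0
  exact (hM.corr_absIncr hh0 hs (by linarith)).symm

end IsModel

lemma corr_comm {Ω : Type*} [MeasurableSpace Ω] (Y Z : Ω → ℝ) (P : Measure Ω) :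
    corr Y Z P = corr Z Y P := by
  rw [corr, corr, covariance_comm, mul_comm]

lemma rho_neg (D lam : ℝ) (ν : Measure ℝ) (u : ℝ) : rho D lam ν (-u) = rho D lam ν u := by
  rw [rho, rho, abs_neg]

end TimeChange

theorem corollary5
    {Ω : Type*} [MeasurableSpace Ω] (P : Measure Ω) [IsProbabilityMeasure P]
    -- the parameters of the model
    (D : ℝ) (hD₀ : 0 < D) (hD₁ : D ≤ 1 / 2)
    (lam : ℝ≥0) (hlam : 0 < lam)
    (ν : Measure ℝ) [IsProbabilityMeasure ν] (hν : ∀ᵐ x ∂ν, 0 < x)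
    -- the three independent sources of randomness
    (W : ℝ≥0 → Ω → ℝ) (hWm : ∀ r, Measurable (W r)) (hW : IsBrownianReal W P)
    (τ : ℤ → Ω → ℝ) (hτ : TimeChange.IsPoissonPoints τ lam P)
    (σ : ℕ → Ω → ℝ) (hσm : ∀ n, Measurable (σ n)) (hσ : ∀ n, HasLaw (σ n) ν P)
    (hσi : iIndepFun σ P)
    (hind₁ : IndepFun (fun ω n => τ n ω) (fun ω n => σ n ω) P)
    (hind₂ : IndepFun (fun ω r => W r ω) (fun ω => ((fun n => τ n ω), (fun n => σ n ω))) P)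
    -- the second moment of the volatility is finite
    (hσ2 : Integrable (fun x => x ^ 2) ν) :
    -- the variances and covariances below are those of square integrable variables, and the
    -- variances in the denominators are positive
    (∀ u h : ℝ, 0 < u → 0 < h →
      MemLp (TimeChange.absIncr D W τ σ h u) 2 P ∧
        0 < Var[TimeChange.absIncr D W τ σ h u; P]) ∧
    (∀ x : ℝ, 0 ≤ x → MemLp (TimeChange.shiftedVol D x) 2 (TimeChange.lawσS ν)) ∧
    (MemLp (TimeChange.limitAbs D) 2 (TimeChange.lawσSW ν) ∧
      0 < Var[TimeChange.limitAbs D; TimeChange.lawσSW ν]) ∧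
    -- the limit of the correlation coefficient
    (∀ s t : ℝ, 0 < s → 0 < t → s ≠ t →
      Tendsto
        (fun h : ℝ => TimeChange.corr (TimeChange.absIncr D W τ σ h s)
          (TimeChange.absIncr D W τ σ h t) P)
        (𝓝[>] 0) (𝓝 (TimeChange.rho D lam ν (t - s)))) := by
  have hM : TimeChange.IsModel P D lam ν W τ σ :=
    ⟨hD₀, hD₁, hlam, hν, hWm, hW, hτ, hσm, hσ, hσi, hind₁, hind₂, hσ2⟩
  refine ⟨fun u h hu hh => ⟨hM.memLp_absIncr hh.le hu.le, hM.variance_absIncr_pos hh hu.le⟩,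
    fun x hx => TimeChange.memLp_shiftedVol hD₀ hD₁ hM.memLp_id hx,
    ⟨TimeChange.memLp_limitAbs hD₀ hD₁ hM.memLp_id,
      TimeChange.variance_limitAbs_pos hD₀ hD₁ hν hM.memLp_id⟩, fun s t hs ht hne => ?_⟩
  rcases lt_or_gt_of_ne hne with h | h
  · exact hM.tendsto_corr_of_lt hs.le h
  -- The case `t < s` follows from symmetry of the correlation and evenness of the limit.
  · have h1 := hM.tendsto_corr_of_lt ht.le h
    rw [← neg_sub, TimeChange.rho_neg] at h1
    exact h1.congr fun _ => TimeChange.corr_comm _ _ _
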